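/- Let $d\ge 5$, let $\lambda>0$, and let $p$ be a probability distribution on $\mathbb{Z}^d$ with finite support and invertible covariance matrix. Consider the Poissonian field of random walks on $\mathbb{Z}^d$ with density $\lambda$ and jump law $p$: let $N_z$, $z\in\mathbb{Z}^d$, be i.i.d. Poisson($\lambda$) random variables and, independently of them, let $Y^{z,i}=(Y^{z,i}_t)_{t\in\mathbb{Z}}$, $z\in\mathbb{Z}^d$, $i\in\mathbb{N}$, be independent two-sided random walks with $Y^{z,i}_0=z$ whose jumps $Y^{z,i}_{t+1}-Y^{z,i}_t$, $t\in\mathbb{Z}$, are i.i.d. with law $p$. For $t\in\mathbb{Z}$ and $x\in\mathbb{Z}^d$ let $\omega_t(x)=1$ if at least one of the walks $Y^{z,i}$, $z\in\mathbb{Z}^d$, $1\le i\le N_z$, is at $x$ at time $t$, and $\omega_t(x)=0$ otherwise. Let $\mathbb{Q}$ denote the underlying probability measure. For a deterministic bi-infinite path $\gamma:\mathbb{Z}\to\mathbb{Z}^d$ write $Z_i=\omega_i(\gamma_i)$, $i\in\mathbb{Z}$. Then there is a constant $C<\infty$, depending only on $d$, $\lambda$ and $p$, such that for every path $\gamma:\mathbb{Z}\to\mathbb{Z}^d$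 and every integer $n\ge 1$, $$\sup_{\sigma,\,l}\ \big\| \mathbb{Q}\big(Z_{[n,\infty)}\in\cdot \,\big|\, Z_{[-l,0]}= \sigma_{[-l,0]}\big)-\mathbb{Q}\big(Z_{[n,\infty)}\in\cdot\big)\big\|_{TV}\ \le\ C\,n^{-\frac d2+2},$$ where the supremum is over all $\sigma\in\{0,1\}^{\mathbb{Z}}$ and all integers $l\ge 0$ for which the conditioning event has positive probability, and $\|\mu-\nu\|_{TV}=\sup_B|\mu(B)-\nu(B)|$ over measurable sets $B$ of sequences. -/

import Mathlib

open MeasureTheory ProbabilityTheory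
open scoped NNReal ENNReal

namespace PoissonWalks

noncomputable section

/-- The integer lattice of dimension `d`. -/
abbrev Lattice (d : ℕ) : Type := Fin d → ℤ

/-- The covariance matrix of a jump law on the lattice. -/
def covMatrix {d : ℕ} (p : PMF (Lattice d)) : Matrix (Fin d) (Fin d) ℝ :=
  Matrix.of fun j k =>
    covariance (fun z : Lattice d => (z j : ℝ)) (fun z : Lattice d => (z k : ℝ)) p.toMeasure

/-- A jump law is truly `d`-dimensional if its covariance matrix is invertible. -/
def TrulyDimensional {d : ℕ} (p : PMF (Lattice d)) : Prop :=
  IsUnit (covMatrix p)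

/-- Sample space of the field of random walks. The first component gives the number of particles
that sit at each site at time `0`; the second gives, for the `i`-th particle of site `z`, its jump
between the times `s` and `s + 1`, for every `s : ℤ`. -/
abbrev Sample (d : ℕ) : Type :=
  (Lattice d → ℕ) × (Lattice d × ℕ × ℤ → Lattice d)

/-- The law of the field: independent Poisson numbers of particles at time `0` and, independently
of them, independent jumps with law `p`. -/
def law {d : ℕ} (lam : ℝ≥0) (p : PMF (Lattice d)) : Measure (Sample d) :=
  (Measure.infinitePi fun _ : Lattice d => poissonMeasure lam).prod
    (Measure.infinitePi fun _ : Lattice d × ℕ × ℤ => p.toMeasure)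

/-- Position at time `t` of the `i`-th particle of site `z`: the two-sided random walk that is at
`z` at time `0` and makes the prescribed jumps. (One of the two sums is always empty.) -/
def position {d : ℕ} (w : Sample d) (z : Lattice d) (i : ℕ) (t : ℤ) : Lattice d :=
  z + ∑ s ∈ Finset.Ico 0 t, w.2 (z, i, s) - ∑ s ∈ Finset.Ico t 0, w.2 (z, i, s)

/-- The number of particles at site `x` at time `t`. -/
def particleCount {d : ℕ} (w : Sample d) (t : ℤ) (x : Lattice d) : ℕ∞ :=
  {q : Lattice d × ℕ | q.2 < w.1 q.1 ∧ position w q.1 q.2 t = x}.encard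

/-- The environment: `1` if there is at least one particle at `x` at time `t`, and `0` if not. -/
def environment {d : ℕ} (w : Sample d) (t : ℤ) (x : Lattice d) : Fin 2 :=
  if 1 ≤ particleCount w t x then 1 else 0

/-- The occupation process along the path `γ`. -/
def occupation {d : ℕ} (γ : ℤ → Lattice d) (w : Sample d) (i : ℤ) : Fin 2 :=
  environment w i (γ i)

/-- The occupation process along `γ` from time `n` on. -/
def future {d : ℕ} (γ : ℤ → Lattice d) (n : ℕ) (w : Sample d) : ℕ → Fin 2 :=
  fun k => occupation γ w ((n : ℤ) + (k : ℤ))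

/-- The event that the occupation process along `γ` agrees with `σ` at the times `-l, …, 0`. -/
def pastEvent {d : ℕ} (γ : ℤ → Lattice d) (l : ℕ) (σ : ℤ → Fin 2) : Set (Sample d) :=
  {w | ∀ i ∈ Set.Icc (-(l : ℤ)) 0, occupation γ w i = σ i}

/-- Total variation distance: the supremum of `|μ B - ν B|` over measurable sets `B`. -/
def tvDist {α : Type*} [MeasurableSpace α] (μ ν : Measure α) : ℝ :=
  ⨆ B : {B : Set α // MeasurableSet B}, |μ.real B.1 - ν.real B.1|

instance {d : ℕ} (lam : ℝ≥0) (p : PMF (Lattice d)) : IsProbabilityMeasure (law lam p) := by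
  unfold law; infer_instance

lemma measurable_position {d : ℕ} (z : Lattice d) (i : ℕ) (t : ℤ) :
    Measurable fun w : Sample d => position w z i t := by
  unfold position
  fun_prop

lemma environment_eq_one_iff {d : ℕ} (w : Sample d) (t : ℤ) (x : Lattice d) :
    environment w t x = 1 ↔ ∃ z i, i < w.1 z ∧ position w z i t = x := by
  have h : 1 ≤ particleCount w t x ↔ ∃ z i, i < w.1 z ∧ position w z i t = x := by
    unfold particleCount
    rw [Set.one_le_encard_iff_nonempty]
    exact ⟨fun ⟨q, hq⟩ => ⟨q.1, q.2, hq⟩, fun ⟨z, i, h⟩ => ⟨(z, i), h⟩⟩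
  rw [← h]
  unfold environment
  split_ifs with h' <;> simp [h']

lemma measurable_environment {d : ℕ} (t : ℤ) (x : Lattice d) :
    Measurable fun w : Sample d => environment w t x := by
  have h1 : MeasurableSet {w : Sample d | environment w t x = 1} := by
    simp only [environment_eq_one_iff, Set.ofPred_exists]
    refine MeasurableSet.iUnion fun z => MeasurableSet.iUnion fun i => ?_
    refine MeasurableSet.inter ?_ ?_
    · exact ((measurable_pi_apply z).comp measurable_fst) (MeasurableSet.of_discrete (s := {k | i < k}))
    · exact measurable_position z i t (measurableSet_singleton x)
  have : (fun w : Sample d => environment w t x) =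
      Set.indicator {w : Sample d | environment w t x = 1} (fun _ => 1) := by
    funext w
    by_cases h : environment w t x = 1
    · simp [h]
    · simp [h]; omega
  rw [this]
  exact measurable_const.indicator h1

/-- The process from time `n` on is a measurable random sequence, so that its law is the image
of the underlying measure. -/
lemma measurable_future {d : ℕ} (γ : ℤ → Lattice d) (n : ℕ) :
    Measurable (future γ n) :=
  measurable_pi_lambda _ fun _ => measurable_environment _ _

lemma measurableSet_pastEvent {d : ℕ} (γ : ℤ → Lattice d) (l : ℕ) (σ : ℤ → Fin 2) :
    MeasurableSet (pastEvent γ l σ) := by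
  have : pastEvent γ l σ = ⋂ i ∈ Set.Icc (-(l : ℤ)) 0,
      (fun w : Sample d => environment w i (γ i)) ⁻¹' {σ i} := by
    ext w; simp [pastEvent, occupation]
  rw [this]
  exact MeasurableSet.biInter (Set.to_countable _) fun i _ =>
    measurable_environment i (γ i) (measurableSet_singleton _)

end

end PoissonWalks

/-! Fix finite sets of times `Tp` (past) and `Tf` (future). By Poisson thinning, the numbers of
walks whose set of visits to the path within `Tp ∪ Tf` equals `H` are independent Poisson variables
with means `m H`, for nonempty `H`. Occupation only records which `H` occur, so the occupied set is
the union of a random family containing each `H` independently with odds `exp (m H) - 1`. The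
thinning itself is never constructed: `law_occupied_subset` computes the void probabilities of the
field, and `law_occupied_mul` shows that they determine the law and agree with the finite model.

Past and future interact only through crossing sets, those that meet both `Tp` and `Tf`. Without
them the future is decided by the sets that miss `Tp`, which are independent of the past. So it
suffices to bound the probability of a crossing set, unconditionally (at most the sum of the `m H`)
and given that the past equals `S`. The second bound must be uniform in `S`, however unlikely `S`
is, and comes from a surgery (`subsetSum_crossing_le`). If erasing the crossing set `H` leaves the
past unchanged, its presence costs a factor `m H`. Otherwise let `r` be the last past time covered
by `H` alone, and replace `H` by a set with the same visits up to `r` and no later past visit. The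
past is still `S`, since all that `H` covers after `r` is covered by other sets. A walk at `r`
continues independently of its earlier visits: it hits `Tf` with probability at most `q r` and
avoids the path with probability at least `δ`, so the surgery costs `exp lam * q r / δ`
(`sum_essentialAt_le`).

Two facts about one walk remain. The heat kernel is `O(t ^ (-d/2))`, by Fourier analysis
(`exists_walkKernel_le`); this bounds `q r` by a sum over `t ∈ Tf` of `C * (t - r) ^ (-d/2)`. The
escape probability is positive uniformly over paths (`exists_escape_bound`). Both error terms are
then controlled by the double sum of `(t - r) ^ (-d/2)` over `r ≤ 0` and `t ≥ n`, of order `n ^ (2 -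
d/2)`. Nothing depends on the finite windows, so the bound passes from cylinder events to all
measurable events. -/

namespace PoissonWalks

/-! ### The finite model: unions of independently chosen sets of times. -/

section FiniteModel

open Finset Real

open Classical in
/-- The indicator of a proposition as a real number. -/
noncomputable def ind (P : Prop) : ℝ := if P then 1 else 0

lemma ind_pos {P : Prop} (h : P) : ind P = 1 := if_pos h

lemma ind_neg {P : Prop} (h : ¬ P) : ind P = 0 := if_neg h

lemma ind_nonneg (P : Prop) : 0 ≤ ind P := by unfold ind; split_ifs <;> norm_num

lemma ind_le_one (P : Prop) : ind P ≤ 1 := by unfold ind; split_ifs <;> norm_num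

lemma ind_and (P Q : Prop) : ind (P ∧ Q) = ind P * ind Q := by
  by_cases hP : P <;> by_cases hQ : Q <;> simp [ind, hP, hQ]

/-- The weighted sum of `f` over the subsets of `U`, a subset `c` having the weight `∏ i ∈ c, a i`.
Up to normalization this is the expectation of `f` if the elements of `U` are chosen
independently with odds `a`. -/
def subsetSum {ι : Type*} (a : ι → ℝ) (U : Finset ι) (f : Finset ι → ℝ) : ℝ :=
  ∑ c ∈ U.powerset, (∏ i ∈ c, a i) * f c

section SubsetSum

variable {ι : Type*} {a : ι → ℝ} {U V : Finset ι} {f g : Finset ι → ℝ}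

lemma subsetSum_congr (h : ∀ c ⊆ U, f c = g c) : subsetSum a U f = subsetSum a U g :=
  Finset.sum_congr rfl fun c hc => by rw [h c (mem_powerset.1 hc)]

lemma subsetSum_mono (ha : ∀ i, 0 ≤ a i) (h : ∀ c ⊆ U, f c ≤ g c) :
    subsetSum a U f ≤ subsetSum a U g :=
  Finset.sum_le_sum fun c hc =>
    mul_le_mul_of_nonneg_left (h c (mem_powerset.1 hc)) (prod_nonneg fun i _ => ha i)

lemma subsetSum_nonneg (ha : ∀ i, 0 ≤ a i) (h : ∀ c ⊆ U, 0 ≤ f c) : 0 ≤ subsetSum a U f :=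
  Finset.sum_nonneg fun c hc =>
    mul_nonneg (prod_nonneg fun i _ => ha i) (h c (mem_powerset.1 hc))

lemma subsetSum_const_mul (k : ℝ) : subsetSum a U (fun c => k * f c) = k * subsetSum a U f := by
  simp only [subsetSum, mul_sum]
  exact Finset.sum_congr rfl fun c _ => by ring

lemma subsetSum_sum {κ : Type*} (s : Finset κ) (F : κ → Finset ι → ℝ) :
    subsetSum a U (fun c => ∑ k ∈ s, F k c) = ∑ k ∈ s, subsetSum a U (F k) := by
  simp only [subsetSum, mul_sum]
  rw [Finset.sum_comm]

lemma subsetSum_sub : subsetSum a U (fun c => f c - g c) = subsetSum a U f - subsetSum a U g := by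
  simp only [subsetSum, mul_sub, Finset.sum_sub_distrib]

lemma abs_subsetSum_le (ha : ∀ i, 0 ≤ a i) :
    |subsetSum a U f| ≤ subsetSum a U (fun c => |f c|) := by
  refine (Finset.abs_sum_le_sum_abs _ _).trans (le_of_eq (Finset.sum_congr rfl fun c _ => ?_))
  rw [abs_mul, abs_of_nonneg (prod_nonneg fun i _ => ha i)]

lemma subsetSum_one : subsetSum a U (fun _ => 1) = ∏ i ∈ U, (1 + a i) := by
  simp [subsetSum, Finset.prod_one_add]

lemma subsetSum_ind {P : Finset ι → Prop} [DecidablePred P] :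
    subsetSum a U (fun c => ind (P c)) = ∑ c ∈ U.powerset with P c, ∏ i ∈ c, a i := by
  rw [subsetSum, Finset.sum_filter]
  refine Finset.sum_congr rfl fun c _ => ?_
  by_cases h : P c <;> simp [ind, h]

variable [DecidableEq ι]

lemma subsetSum_insert {i : ι} (hi : i ∉ U) :
    subsetSum a (insert i U) f = subsetSum a U f + a i * subsetSum a U (fun c => f (insert i c)) := by
  simp only [subsetSum]
  rw [Finset.sum_powerset_insert hi, mul_sum]
  congr 1
  refine Finset.sum_congr rfl fun c hc => ?_
  rw [prod_insert fun h => hi (mem_powerset.1 hc h)]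
  ring

/-- Independence: choices inside disjoint sets do not interact, so expectations of products
factorize. -/
lemma subsetSum_union_mul (h : Disjoint U V) :
    subsetSum a (U ∪ V) (fun c => f (c ∩ U) * g (c ∩ V)) = subsetSum a U f * subsetSum a V g := by
  induction U using Finset.induction_on generalizing f with
  | empty =>
    simp only [empty_union, inter_empty]
    rw [subsetSum_congr (g := fun c => f ∅ * g c)
      fun c hc => by rw [inter_eq_left.2 hc], subsetSum_const_mul]
    simp [subsetSum]
  | insert i U hi ih =>
    rw [disjoint_insert_left] at h
    have hiUV : i ∉ U ∪ V := by simp [hi, h.1]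
    rw [insert_union, subsetSum_insert hiUV, subsetSum_insert hi, add_mul, mul_assoc,
      ← ih h.2, ← ih h.2]
    congr 1
    · refine subsetSum_congr fun c hc => ?_
      rw [inter_insert_of_notMem fun hic => hiUV (hc hic)]
    · congr 1
      refine subsetSum_congr fun c _ => ?_
      rw [← insert_inter_distrib, insert_inter_of_notMem h.1]

open Classical in
/-- Removing an element `i` with odds `exp m - 1` costs at most a factor `m`. -/
lemma subsetSum_erase_le (ha : ∀ i, 0 ≤ a i) {i : ι} (hi : i ∈ U) {m : ℝ} (hm : a i = exp m - 1)
    (P : Finset ι → Prop) :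
    subsetSum a U (fun c => ind (i ∈ c ∧ P c ∧ P (c.erase i)))
      ≤ m * subsetSum a U (fun c => ind (P c)) := by
  -- Since `1 + a i = exp m`, this is `1 - exp (-m) ≤ m`: the probability of choosing `i` is at most
  -- its Poisson mean.
  have ham : a i ≤ m * (1 + a i) := by
    have h1 := add_one_le_exp (-m)
    have h2 : exp m * exp (-m) = 1 := by rw [← exp_add]; simp
    rw [hm]
    nlinarith [exp_pos m]
  have hm0 : 0 ≤ m := by
    have := ha i
    rw [hm] at this
    exact one_le_exp_iff.1 (by linarith)
  -- Subsets are paired as `c`, `insert i c` with `i ∉ c`. A pair contributes on the left only if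
  -- both members satisfy `P`, with weight `a i` against `m * (1 + a i)` on the right.
  rw [← insert_erase hi, subsetSum_insert (notMem_erase i U), subsetSum_insert (notMem_erase i U)]
  have hni : ∀ c ⊆ U.erase i, i ∉ c := fun c hc h => notMem_erase i U (hc h)
  rw [subsetSum_congr (g := fun _ => 0 * 1) fun c hc => by simp [ind, hni c hc], subsetSum_const_mul,
    zero_mul, zero_add, mul_add, ← mul_assoc, ← subsetSum_const_mul, ← subsetSum_const_mul,
    ← subsetSum_const_mul]
  simp only [subsetSum]
  rw [← Finset.sum_add_distrib]
  refine Finset.sum_le_sum fun c hc => ?_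
  rw [erase_insert (hni c (mem_powerset.1 hc)), ← mul_add]
  refine mul_le_mul_of_nonneg_left ?_ (prod_nonneg fun i _ => ha i)
  have := mul_nonneg hm0 (ha i)
  by_cases h1 : P (insert i c) <;> by_cases h2 : P c <;> simp [ind, h1, h2] <;> nlinarith

end SubsetSum

/-- The union of the sets of a configuration. -/
def cover (c : Finset (Finset ℤ)) : Finset ℤ := c.sup id

lemma mem_cover {c : Finset (Finset ℤ)} {t : ℤ} : t ∈ cover c ↔ ∃ H ∈ c, t ∈ H := by
  simp [cover, Finset.mem_sup]

lemma cover_insert (H : Finset ℤ) (c : Finset (Finset ℤ)) :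
    cover (insert H c) = H ∪ cover c := by
  simp [cover]

/-- The part of `H` in `Tp` strictly before `r`. -/
def before (Tp : Finset ℤ) (r : ℤ) (H : Finset ℤ) : Finset ℤ := (H ∩ Tp).filter (· < r)

/-- `H` is the only set of the configuration `c` that contains `r`, and all points of `S` that
`H` covers after `r` are covered by the rest of `c`. -/
def EssentialAt (Tp S : Finset ℤ) (c : Finset (Finset ℤ)) (H : Finset ℤ) (r : ℤ) : Prop :=
  r ∈ H ∧ (∀ H' ∈ c, r ∈ H' → H' = H) ∧
    insert r (before Tp r H ∪ (cover (c.erase H) ∩ Tp)) = S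

/-- The past times that only `H` covers form a nonempty set, and `r` is its last element; by
maximality, later past points of `H` are covered by other sets. -/
lemma exists_essentialAt {Tp S H : Finset ℤ} {c : Finset (Finset ℤ)} (hH : H ∈ c)
    (hc : cover c ∩ Tp = S) (h : cover (c.erase H) ∩ Tp ≠ S) :
    ∃ r ∈ Tp, EssentialAt Tp S c H r := by
  have hcov : cover c = H ∪ cover (c.erase H) := by
    rw [← cover_insert, insert_erase hH]
  set E := (H ∩ Tp) \ cover (c.erase H) with hE
  have hne : E.Nonempty := by
    rw [nonempty_iff_ne_empty]
    intro h0
    apply h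
    rw [← hc, hcov, union_inter_distrib_right]
    have h1 : H ∩ Tp ⊆ cover (c.erase H) := by rwa [← sdiff_eq_empty_iff_subset]
    exact (union_eq_right.2 (subset_inter h1 inter_subset_right)).symm
  obtain ⟨r, hr, hmax⟩ : ∃ r ∈ E, ∀ t ∈ E, t ≤ r := ⟨E.max' hne, E.max'_mem hne, E.le_max'⟩
  simp only [hE, mem_sdiff, mem_inter] at hr hmax
  refine ⟨r, hr.1.2, hr.1.1, fun H' hH' hrH' => ?_, ?_⟩
  · by_contra hne
    exact hr.2 (mem_cover.2 ⟨H', mem_erase.2 ⟨hne, hH'⟩, hrH'⟩)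
  · rw [← hc, hcov]
    ext t
    simp only [before, mem_insert, mem_union, mem_filter, mem_inter]
    constructor
    · rintro (rfl | h | h)
      · exact ⟨Or.inl hr.1.1, hr.1.2⟩
      · exact ⟨Or.inl h.1.1, h.1.2⟩
      · exact ⟨Or.inr h.1, h.2⟩
    · rintro ⟨h1 | h1, h2⟩
      · by_cases h3 : t ∈ cover (c.erase H)
        · exact Or.inr (Or.inr ⟨h3, h2⟩)
        · rcases (hmax t ⟨⟨h1, h2⟩, h3⟩).eq_or_lt with h4 | h4
          · exact Or.inl h4
          · exact Or.inr (Or.inl ⟨⟨h1, h2⟩, h4⟩)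
      · exact Or.inr (Or.inr ⟨h1, h2⟩)

/-! ### Surgery on crossing sets and decoupling. -/

section Decoupling

variable {U : Finset (Finset ℤ)} {Tp Tf S : Finset ℤ} {m a : Finset ℤ → ℝ}

open Classical in
/-- The weight of the configurations of sets that do not contain `r` and that cover `S` in `Tp`
together with `b` and `r`. -/
noncomputable def restWeight (a : Finset ℤ → ℝ) (U : Finset (Finset ℤ)) (Tp S : Finset ℤ) (r : ℤ)
    (b : Finset ℤ) : ℝ :=
  ∑ c ∈ (U.filter (r ∉ ·)).powerset with insert r (b ∪ (cover c ∩ Tp)) = S, ∏ H ∈ c, a H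

lemma restWeight_nonneg (ha : ∀ H, 0 ≤ a H) (r : ℤ) (b : Finset ℤ) :
    0 ≤ restWeight a U Tp S r b :=
  Finset.sum_nonneg fun _ _ => prod_nonneg fun i _ => ha i

-- Erasing `H` loses nothing, as `H` is known. By essentiality the remainder has no set through `r`,
-- and the constraint left on it involves `H` only through its visits before `r`.
open Classical in
lemma subsetSum_essentialAt_le (ha : ∀ H, 0 ≤ a H) (r : ℤ) (H : Finset ℤ) :
    subsetSum a U (fun c => ind (H ∈ c ∧ EssentialAt Tp S c H r))
      ≤ a H * restWeight a U Tp S r (before Tp r H) := by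
  rw [subsetSum_ind, restWeight, mul_sum]
  have hinj : Set.InjOn (fun c : Finset (Finset ℤ) => c.erase H)
      (U.powerset.filter fun c => H ∈ c ∧ EssentialAt Tp S c H r) := by
    intro c hc c' hc' h
    simp only [coe_filter, Set.mem_ofPred_eq] at hc hc'
    rw [← insert_erase hc.2.1, ← insert_erase hc'.2.1]
    exact congrArg _ h
  calc ∑ c ∈ U.powerset with H ∈ c ∧ EssentialAt Tp S c H r, ∏ i ∈ c, a i
      = ∑ c ∈ U.powerset with H ∈ c ∧ EssentialAt Tp S c H r, a H * ∏ i ∈ c.erase H, a i := by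
        refine Finset.sum_congr rfl fun c hc => ?_
        exact (mul_prod_erase _ _ (mem_filter.1 hc).2.1).symm
    _ = ∑ c ∈ (U.powerset.filter fun c => H ∈ c ∧ EssentialAt Tp S c H r).image
          (fun c => c.erase H), a H * ∏ i ∈ c, a i :=
          (Finset.sum_image (f := fun c => a H * ∏ i ∈ c, a i) hinj).symm
    _ ≤ _ := by
        refine Finset.sum_le_sum_of_subset_of_nonneg ?_
          fun c _ _ => mul_nonneg (ha H) (prod_nonneg fun i _ => ha i)
        intro c' hc'
        obtain ⟨c, hc, rfl⟩ := mem_image.1 hc'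
        rw [mem_filter, mem_powerset] at hc
        obtain ⟨hcU, hHc, hr, huniq, hS⟩ := hc
        simp only [mem_filter, mem_powerset]
        refine ⟨fun H' hH' => ?_, hS⟩
        rw [mem_erase] at hH'
        exact mem_filter.2 ⟨hcU hH'.2, fun h => hH'.1 (huniq H' hH'.2 h)⟩

-- The reverse half of the surgery: inserting into a remainder a set whose last past time is `r`
-- produces the past `S`. The inserted set is the only one through `r`, so the pair can be recovered
-- and no configuration is counted twice.
open Classical in
lemma sum_mul_restWeight_le (ha : ∀ H, 0 ≤ a H) (r : ℤ) :
    ∑ H ∈ U with H ∩ Tp = insert r (before Tp r H), a H * restWeight a U Tp S r (before Tp r H)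
      ≤ subsetSum a U (fun c => ind (cover c ∩ Tp = S)) := by
  rw [subsetSum_ind]
  simp only [restWeight, mul_sum]
  rw [Finset.sum_sigma']
  set X := (U.filter fun H => H ∩ Tp = insert r (before Tp r H)).sigma fun H =>
    (U.filter (r ∉ ·)).powerset.filter fun c => insert r (before Tp r H ∪ (cover c ∩ Tp)) = S
    with hX
  have hmem : ∀ x ∈ X, x.1 ∈ U ∧ x.1 ∩ Tp = insert r (before Tp r x.1) ∧
      (∀ H ∈ x.2, H ∈ U ∧ r ∉ H) ∧ insert r (before Tp r x.1 ∪ (cover x.2 ∩ Tp)) = S := by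
    intro x hx
    simp only [hX, mem_sigma, mem_filter, mem_powerset] at hx
    exact ⟨hx.1.1, hx.1.2, fun H hH => mem_filter.1 (hx.2.1 hH), hx.2.2⟩
  have hr1 : ∀ x ∈ X, r ∈ x.1 := fun x hx => by
    have : r ∈ x.1 ∩ Tp := by rw [(hmem x hx).2.1]; simp
    exact (mem_inter.1 this).1
  have hnot : ∀ x ∈ X, x.1 ∉ x.2 := fun x hx h => ((hmem x hx).2.2.1 _ h).2 (hr1 x hx)
  have hinj : Set.InjOn (fun x : (_ : Finset ℤ) × Finset (Finset ℤ) => insert x.1 x.2) X := by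
    intro x hx y hy h
    have h1 : x.1 = y.1 := by
      have : x.1 ∈ insert y.1 y.2 := by
        have h' : insert x.1 x.2 = insert y.1 y.2 := h
        rw [← h']; simp
      rcases mem_insert.1 this with h | h
      · exact h
      · exact absurd (hr1 x hx) ((hmem y hy).2.2.1 _ h).2
    have h2 : x.2 = y.2 := by
      rw [← erase_insert (hnot x hx), ← erase_insert (hnot y hy)]
      have h' : insert x.1 x.2 = insert y.1 y.2 := h
      rw [h', h1]
    obtain ⟨x1, x2⟩ := x
    obtain ⟨y1, y2⟩ := y
    simp only at h1 h2
    rw [h1, h2]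
  calc ∑ x ∈ X, a x.1 * ∏ H ∈ x.2, a H
      = ∑ x ∈ X, ∏ H ∈ insert x.1 x.2, a H :=
        Finset.sum_congr rfl fun x hx => (prod_insert (hnot x hx)).symm
    _ = ∑ c ∈ X.image (fun x => insert x.1 x.2), ∏ H ∈ c, a H :=
          (Finset.sum_image (f := fun c => ∏ H ∈ c, a H) hinj).symm
    _ ≤ _ := by
        refine Finset.sum_le_sum_of_subset_of_nonneg ?_ fun c _ _ => prod_nonneg fun i _ => ha i
        intro c hc
        obtain ⟨x, hx, rfl⟩ := mem_image.1 hc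
        obtain ⟨h1, h2, h3, h4⟩ := hmem x hx
        simp only [mem_filter, mem_powerset]
        refine ⟨insert_subset h1 fun H hH => (h3 H hH).1, ?_⟩
        rw [cover_insert, union_inter_distrib_right, h2, insert_union, h4]

lemma before_mem (r : ℤ) (H : Finset ℤ) : before Tp r H ∈ (Tp.filter (· < r)).powerset := by
  rw [mem_powerset]
  intro t ht
  simp only [before, mem_filter, mem_inter] at ht ⊢
  exact ⟨ht.1.2, ht.2⟩

lemma before_eq_of_inter_eq {r : ℤ} {H b : Finset ℤ} (hb : b ⊆ Tp.filter (· < r))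
    (h : H ∩ Tp = insert r b) : before Tp r H = b := by
  rw [before, h]
  ext t
  simp only [mem_filter, mem_insert]
  constructor
  · rintro ⟨rfl | h, h'⟩
    · exact absurd h' (lt_irrefl _)
    · exact h
  · exact fun h => ⟨Or.inr h, (mem_filter.1 (hb h)).2⟩

/-- The hypotheses on the intensities `m` of the sets of visits: the total intensity of the sets
that contain `r` is at most `lam`; a walk at `r` visits `Tf` with probability at most `q r` and
avoids the rest of `Tp` after `r` with probability at least `δ`, both independently of its visits
before `r`. -/
structure IntensityBounds (U : Finset (Finset ℤ)) (Tp Tf : Finset ℤ) (m : Finset ℤ → ℝ)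
    (lam δ : ℝ) (q : ℤ → ℝ) (β : ℤ → Finset ℤ → ℝ) : Prop where
  nonneg : ∀ H, 0 ≤ m H
  pos : 0 < δ
  total : ∀ r ∈ Tp, ∑ H ∈ U with r ∈ H, m H ≤ lam
  hit : ∀ r ∈ Tp, ∀ b ⊆ Tp.filter (· < r),
    ∑ H ∈ U with r ∈ H ∧ before Tp r H = b ∧ (H ∩ Tf).Nonempty, m H ≤ q r * β r b
  hit_nonneg : ∀ r ∈ Tp, 0 ≤ q r
  escape : ∀ r ∈ Tp, ∀ b ⊆ Tp.filter (· < r),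
    δ * β r b ≤ ∑ H ∈ U with H ∩ Tp = insert r b, m H

variable {lam δ : ℝ} {q : ℤ → ℝ} {β : ℤ → Finset ℤ → ℝ}

-- After grouping by the visits `b` before `r`, the weight of the remainder is common to the sets
-- that hit `Tf` and to their replacements, so only the ratio of intensities, at most `q r / δ`,
-- matters. The factor `exp lam` is the price of passing from odds to intensities.
open Classical in
lemma sum_essentialAt_le (hB : IntensityBounds U Tp Tf m lam δ q β)
    (ham : ∀ H, a H = exp (m H) - 1) {r : ℤ} (hr : r ∈ Tp) :
    ∑ H ∈ U with (H ∩ Tf).Nonempty,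
        subsetSum a U (fun c => ind (H ∈ c ∧ EssentialAt Tp S c H r))
      ≤ exp lam / δ * q r * subsetSum a U (fun c => ind (cover c ∩ Tp = S)) := by
  have ha : ∀ H, 0 ≤ a H := fun H => by
    rw [ham, sub_nonneg]; exact one_le_exp (hB.nonneg H)
  have hma : ∀ H, m H ≤ a H := fun H => by
    rw [ham]; linarith [add_one_le_exp (m H)]
  -- This is `exp m - 1 ≤ m * exp m`, with `m H ≤ lam` because `H` is one of the sets through `r`.
  have hle : ∀ H ∈ U, r ∈ H → a H ≤ exp lam * m H := by
    intro H hH hrH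
    have h1 : m H ≤ lam :=
      (Finset.single_le_sum (f := m) (fun H _ => hB.nonneg H)
        (mem_filter.2 ⟨hH, hrH⟩)).trans (hB.total r hr)
    have h2 := add_one_le_exp (-m H)
    have h3 : exp (m H) * exp (-m H) = 1 := by rw [← exp_add]; simp
    have h4 : exp (m H) ≤ exp lam := exp_le_exp.2 h1
    have h5 := hB.nonneg H
    rw [ham]
    nlinarith [exp_pos (m H)]
  set W := restWeight a U Tp S r with hW
  have hWn : ∀ b, 0 ≤ W b := restWeight_nonneg ha r
  set Bs := (Tp.filter (· < r)).powerset
  calc ∑ H ∈ U with (H ∩ Tf).Nonempty,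
        subsetSum a U (fun c => ind (H ∈ c ∧ EssentialAt Tp S c H r))
      ≤ ∑ H ∈ U with (H ∩ Tf).Nonempty,
        if r ∈ H then exp lam * (m H * W (before Tp r H)) else 0 := by
        refine Finset.sum_le_sum fun H hH => ?_
        split_ifs with hrH
        · refine (subsetSum_essentialAt_le ha r H).trans ?_
          rw [← mul_assoc]
          exact mul_le_mul_of_nonneg_right (hle H (mem_filter.1 hH).1 hrH) (hWn _)
        · refine le_of_eq ?_
          rw [subsetSum_congr (g := fun _ => 0 * 1) fun c _ => by simp [ind, EssentialAt, hrH],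
            subsetSum_const_mul, zero_mul]
    _ = ∑ b ∈ Bs, ∑ H ∈ U with r ∈ H ∧ before Tp r H = b ∧ (H ∩ Tf).Nonempty,
          exp lam * (m H * W b) := by
        rw [← Finset.sum_filter, filter_filter,
          ← Finset.sum_fiberwise_of_maps_to (t := Bs) (g := before Tp r) fun H _ => before_mem r H]
        refine Finset.sum_congr rfl fun b _ => ?_
        rw [filter_filter]
        refine Finset.sum_congr ?_ fun H hH => ?_
        · ext H; simp only [mem_filter]; tauto
        · rw [(mem_filter.1 hH).2.2.1]
    _ = ∑ b ∈ Bs, exp lam * W b *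
          ∑ H ∈ U with r ∈ H ∧ before Tp r H = b ∧ (H ∩ Tf).Nonempty, m H := by
        refine Finset.sum_congr rfl fun b _ => ?_
        rw [mul_sum]
        exact Finset.sum_congr rfl fun H _ => by ring
    -- The auxiliary intensity `β r b` is eliminated here between `hit` and `escape`.
    _ ≤ ∑ b ∈ Bs, exp lam * W b * (q r * (δ⁻¹ * ∑ H ∈ U with H ∩ Tp = insert r b, m H)) := by
        refine Finset.sum_le_sum fun b hb => mul_le_mul_of_nonneg_left ?_
          (mul_nonneg (exp_pos _).le (hWn b))
        refine (hB.hit r hr b (mem_powerset.1 hb)).trans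
          (mul_le_mul_of_nonneg_left ?_ (hB.hit_nonneg r hr))
        rw [← div_eq_inv_mul, le_div_iff₀ hB.pos, mul_comm]
        exact hB.escape r hr b (mem_powerset.1 hb)
    _ = exp lam / δ * q r * ∑ b ∈ Bs, ∑ H ∈ U with H ∩ Tp = insert r b, m H * W b := by
        rw [mul_sum]
        refine Finset.sum_congr rfl fun b _ => ?_
        rw [← sum_mul]
        field_simp
    _ ≤ exp lam / δ * q r *
          ∑ H ∈ U with H ∩ Tp = insert r (before Tp r H), a H * W (before Tp r H) := by
        refine mul_le_mul_of_nonneg_left ?_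
          (mul_nonneg (div_nonneg (exp_pos _).le hB.pos.le) (hB.hit_nonneg r hr))
        rw [← Finset.sum_fiberwise_of_maps_to (t := Bs) (g := before Tp r)
          (s := U.filter _) fun H _ => before_mem r H]
        refine Finset.sum_le_sum fun b hb => ?_
        rw [filter_filter]
        refine le_trans (le_of_eq (Finset.sum_congr ?_ fun _ _ => rfl))
          (Finset.sum_le_sum (f := fun H => m H * W b) fun H hH => ?_)
        · ext H
          simp only [mem_filter]
          constructor
          · rintro ⟨h1, h2⟩
            have := before_eq_of_inter_eq (mem_powerset.1 hb) h2
            exact ⟨h1, by rw [this, h2], this⟩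
          · rintro ⟨h1, h2, h3⟩
            exact ⟨h1, by rw [h2, h3]⟩
        · rw [(mem_filter.1 hH).2.2]
          exact mul_le_mul_of_nonneg_right (hma H) (hWn b)
    _ ≤ _ := by
        refine mul_le_mul_of_nonneg_left (sum_mul_restWeight_le ha r)
          (mul_nonneg (div_nonneg (exp_pos _).le hB.pos.le) (hB.hit_nonneg r hr))

/-- The sets that meet both the past and the future. -/
def crossing (U : Finset (Finset ℤ)) (Tp Tf : Finset ℤ) : Finset (Finset ℤ) :=
  U.filter fun H => (H ∩ Tp).Nonempty ∧ (H ∩ Tf).Nonempty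

-- A union bound over the crossing sets present, each of which is either erasable without changing
-- the past or essential at some past time.
open Classical in
lemma subsetSum_crossing_le (hB : IntensityBounds U Tp Tf m lam δ q β)
    (ham : ∀ H, a H = exp (m H) - 1) :
    subsetSum a U (fun c => ind (cover c ∩ Tp = S ∧ (c ∩ crossing U Tp Tf).Nonempty))
      ≤ (∑ H ∈ crossing U Tp Tf, m H + exp lam / δ * ∑ r ∈ Tp, q r) *
        subsetSum a U (fun c => ind (cover c ∩ Tp = S)) := by
  have ha : ∀ H, 0 ≤ a H := fun H => by
    rw [ham, sub_nonneg]; exact one_le_exp (hB.nonneg H)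
  set X := crossing U Tp Tf with hX
  set P : Finset (Finset ℤ) → Prop := fun c => cover c ∩ Tp = S with hP
  calc subsetSum a U (fun c => ind (P c ∧ (c ∩ X).Nonempty))
      ≤ subsetSum a U (fun c => ∑ H ∈ X, ((ind (H ∈ c ∧ P c ∧ P (c.erase H)))
          + ∑ r ∈ Tp, ind (H ∈ c ∧ EssentialAt Tp S c H r))) := by
        refine subsetSum_mono ha fun c _ => ?_
        have hsn : ∀ H ∈ X, (0 : ℝ) ≤ (ind (H ∈ c ∧ P c ∧ P (c.erase H)))
            + ∑ r ∈ Tp, ind (H ∈ c ∧ EssentialAt Tp S c H r) := fun H _ =>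
          add_nonneg (ind_nonneg _) (Finset.sum_nonneg fun r _ => ind_nonneg _)
        by_cases h : P c ∧ (c ∩ X).Nonempty
        · rw [ind_pos h]
          obtain ⟨hc, H, hH⟩ := h
          rw [mem_inter] at hH
          refine le_trans ?_ (Finset.single_le_sum hsn hH.2)
          by_cases hE : P (c.erase H)
          · rw [ind_pos ⟨hH.1, hc, hE⟩]
            linarith [Finset.sum_nonneg (s := Tp)
              (f := fun r => ind (H ∈ c ∧ EssentialAt Tp S c H r)) fun r _ => ind_nonneg _]
          · obtain ⟨r, hr, hess⟩ := exists_essentialAt hH.1 hc hE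
            have := Finset.single_le_sum (s := Tp)
              (f := fun r => ind (H ∈ c ∧ EssentialAt Tp S c H r))
              (fun r _ => ind_nonneg _) hr
            rw [ind_pos ⟨hH.1, hess⟩] at this
            linarith [ind_nonneg (H ∈ c ∧ P c ∧ P (c.erase H))]
        · rw [ind_neg h]
          exact Finset.sum_nonneg hsn
    _ = ∑ H ∈ X, subsetSum a U (fun c => ind (H ∈ c ∧ P c ∧ P (c.erase H)))
        + ∑ r ∈ Tp, ∑ H ∈ X,
          subsetSum a U (fun c => ind (H ∈ c ∧ EssentialAt Tp S c H r)) := by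
        rw [subsetSum_sum, Finset.sum_comm (s := Tp), ← Finset.sum_add_distrib]
        refine Finset.sum_congr rfl fun H _ => ?_
        rw [← subsetSum_sum]
        simp only [subsetSum, mul_add, Finset.sum_add_distrib]
    _ ≤ ∑ H ∈ X, m H * subsetSum a U (fun c => ind (P c))
        + ∑ r ∈ Tp, exp lam / δ * q r * subsetSum a U (fun c => ind (P c)) := by
        refine add_le_add (Finset.sum_le_sum fun H hH => ?_) (Finset.sum_le_sum fun r hr => ?_)
        · exact subsetSum_erase_le ha (mem_filter.1 hH).1 (ham H) P
        · refine le_trans (Finset.sum_le_sum_of_subset_of_nonneg ?_ fun H _ _ =>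
            subsetSum_nonneg ha fun c _ => ind_nonneg _) (sum_essentialAt_le hB ham hr)
          intro H hH
          simp only [hX, crossing, mem_filter] at hH ⊢
          exact ⟨hH.1, hH.2.2⟩
    _ = _ := by
        rw [← sum_mul, ← sum_mul, ← mul_sum]
        ring

open Classical in
/-- Decoupling of the past and the future in the finite model. -/
theorem abs_subsetSum_sub_le (hB : IntensityBounds U Tp Tf m lam δ q β)
    (ham : ∀ H, a H = exp (m H) - 1) (B : Finset ℤ → Prop) :
    |subsetSum a U (fun c => ind (cover c ∩ Tp = S ∧ B (cover c ∩ Tf)))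
        * subsetSum a U (fun _ => 1)
      - subsetSum a U (fun c => ind (cover c ∩ Tp = S))
        * subsetSum a U (fun c => ind (B (cover c ∩ Tf)))|
      ≤ (2 * ∑ H ∈ crossing U Tp Tf, m H + exp lam / δ * ∑ r ∈ Tp, q r) *
        (subsetSum a U (fun c => ind (cover c ∩ Tp = S))
          * subsetSum a U (fun _ => 1)) := by
  have ha : ∀ H, 0 ≤ a H := fun H => by
    rw [ham, sub_nonneg]; exact one_le_exp (hB.nonneg H)
  set X := crossing U Tp Tf with hX
  -- The sets in `A` alone decide the past; when no crossing set is present, those in `N` alone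
  -- decide the future.
  set A := U.filter fun H => (H ∩ Tp).Nonempty with hA
  set N := U.filter fun H => ¬ (H ∩ Tp).Nonempty with hN
  have hAN : A ∪ N = U := filter_union_filter_not_eq _ _
  have hdisj : Disjoint A N := disjoint_filter_filter_not _ _ _
  set f : Finset (Finset ℤ) → ℝ := fun c => ind (cover c ∩ Tp = S) with hf
  set g : Finset (Finset ℤ) → ℝ := fun c => ind (B (cover c ∩ Tf)) with hg
  have hf01 : ∀ c, 0 ≤ f c ∧ f c ≤ 1 := fun c => ⟨ind_nonneg _, ind_le_one _⟩
  have hg01 : ∀ c, 0 ≤ g c ∧ g c ≤ 1 := fun c => ⟨ind_nonneg _, ind_le_one _⟩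
  have hfg : (fun c => ind (cover c ∩ Tp = S ∧ B (cover c ∩ Tf)))
      = fun c => f c * g c := by
    funext c
    exact ind_and _ _
  have hfA : ∀ c ⊆ U, f (c ∩ A) = f c := by
    intro c hc
    have : cover (c ∩ A) ∩ Tp = cover c ∩ Tp := by
      ext t
      simp only [mem_inter, mem_cover, hA, mem_filter]
      constructor
      · rintro ⟨⟨H, hH, htH⟩, ht⟩
        exact ⟨⟨H, hH.1, htH⟩, ht⟩
      · rintro ⟨⟨H, hH, htH⟩, ht⟩
        exact ⟨⟨H, ⟨hH, hc hH, t, mem_inter.2 ⟨htH, ht⟩⟩, htH⟩, ht⟩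
    simp only [hf, this]
  have hgN : ∀ c ⊆ U, ¬ (c ∩ X).Nonempty → g (c ∩ N) = g c := by
    intro c hc hX'
    have : cover (c ∩ N) ∩ Tf = cover c ∩ Tf := by
      ext t
      simp only [mem_inter, mem_cover, hN, mem_filter]
      constructor
      · rintro ⟨⟨H, hH, htH⟩, ht⟩
        exact ⟨⟨H, hH.1, htH⟩, ht⟩
      · rintro ⟨⟨H, hH, htH⟩, ht⟩
        refine ⟨⟨H, ⟨hH, hc hH, fun h => hX' ⟨H, ?_⟩⟩, htH⟩, ht⟩
        rw [mem_inter, hX, crossing, mem_filter]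
        exact ⟨hH, hc hH, h, t, mem_inter.2 ⟨htH, ht⟩⟩
    simp only [hg, this]
  set e : Finset (Finset ℤ) → ℝ := fun c => ind ((c ∩ X).Nonempty) with he
  have hge : ∀ c ⊆ U, |g c - g (c ∩ N)| ≤ e c := by
    intro c hc
    simp only [he]
    by_cases h : (c ∩ X).Nonempty
    · rw [ind_pos h, abs_le]
      constructor <;> linarith [hg01 c, hg01 (c ∩ N)]
    · rw [hgN c hc h, sub_self, abs_zero]
      exact ind_nonneg _
  have hind : subsetSum a U (fun c => f c * g (c ∩ N)) * subsetSum a U (fun _ => 1)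
      = subsetSum a U f * subsetSum a U (fun c => g (c ∩ N)) := by
    have h1 : subsetSum a U (fun c => f c * g (c ∩ N)) = subsetSum a A f * subsetSum a N g := by
      rw [← subsetSum_union_mul hdisj, hAN]
      exact subsetSum_congr fun c hc => by rw [hfA c hc]
    have h2 : subsetSum a U (fun _ => 1)
        = subsetSum a A (fun _ => 1) * subsetSum a N (fun _ => 1) := by
      rw [← subsetSum_union_mul hdisj, hAN]
      simp
    have h3 : subsetSum a U f = subsetSum a A f * subsetSum a N (fun _ => 1) := by
      rw [← subsetSum_union_mul hdisj, hAN]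
      exact subsetSum_congr fun c hc => by rw [hfA c hc, mul_one]
    have h4 : subsetSum a U (fun c => g (c ∩ N)) = subsetSum a A (fun _ => 1) * subsetSum a N g := by
      rw [← subsetSum_union_mul hdisj, hAN]
      simp
    rw [h1, h2, h3, h4]
    ring
  have hZ : 0 ≤ subsetSum a U (fun _ => 1) := subsetSum_nonneg ha fun _ _ => zero_le_one
  have hF : 0 ≤ subsetSum a U f := subsetSum_nonneg ha fun c _ => (hf01 c).1
  have hd1 : |subsetSum a U (fun c => f c * g c) - subsetSum a U (fun c => f c * g (c ∩ N))|
      ≤ (∑ H ∈ X, m H + exp lam / δ * ∑ r ∈ Tp, q r) * subsetSum a U f := by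
    refine le_trans ?_ (subsetSum_crossing_le hB ham)
    rw [← subsetSum_sub]
    refine (abs_subsetSum_le ha).trans (subsetSum_mono ha fun c hc => ?_)
    rw [← mul_sub, abs_mul, abs_of_nonneg (hf01 c).1]
    refine (mul_le_mul_of_nonneg_left (hge c hc) (hf01 c).1).trans (le_of_eq ?_)
    exact (ind_and _ _).symm
  -- The unconditional cost of ignoring crossing sets, which accounts for the factor `2` before the
  -- crossing sum.
  have hd2 : |subsetSum a U g - subsetSum a U (fun c => g (c ∩ N))|
      ≤ (∑ H ∈ X, m H) * subsetSum a U (fun _ => 1) := by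
    rw [← subsetSum_sub, sum_mul]
    refine (abs_subsetSum_le ha).trans ((subsetSum_mono (g := fun c => ∑ H ∈ X, ind (H ∈ c)) ha
      fun c hc => (hge c hc).trans ?_).trans ?_)
    · simp only [he]
      have hn : ∀ H ∈ X, 0 ≤ ind (H ∈ c) := fun H _ => ind_nonneg _
      by_cases h : (c ∩ X).Nonempty
      · rw [ind_pos h]
        obtain ⟨H, hH⟩ := h
        rw [mem_inter] at hH
        refine le_trans ?_ (Finset.single_le_sum hn hH.2)
        rw [ind_pos hH.1]
      · rw [ind_neg h]
        exact Finset.sum_nonneg hn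
    · rw [subsetSum_sum]
      refine Finset.sum_le_sum fun H hH => ?_
      have := subsetSum_erase_le ha (mem_filter.1 hH).1 (ham H) (fun _ => True)
      have h1 : ind True = 1 := ind_pos trivial
      simpa only [and_true, h1] using this
  rw [hfg]
  calc |subsetSum a U (fun c => f c * g c) * subsetSum a U (fun _ => 1)
        - subsetSum a U f * subsetSum a U g|
      = |(subsetSum a U (fun c => f c * g c) - subsetSum a U (fun c => f c * g (c ∩ N)))
          * subsetSum a U (fun _ => 1)
        - subsetSum a U f * (subsetSum a U g - subsetSum a U (fun c => g (c ∩ N)))| := by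
        congr 1
        rw [sub_mul, mul_sub, hind]
        ring
    _ ≤ |subsetSum a U (fun c => f c * g c) - subsetSum a U (fun c => f c * g (c ∩ N))|
          * subsetSum a U (fun _ => 1)
        + subsetSum a U f * |subsetSum a U g - subsetSum a U (fun c => g (c ∩ N))| := by
        refine (abs_sub _ _).trans (le_of_eq ?_)
        rw [abs_mul, abs_mul, abs_of_nonneg hZ, abs_of_nonneg hF]
    _ ≤ (∑ H ∈ X, m H + exp lam / δ * ∑ r ∈ Tp, q r) * subsetSum a U f
          * subsetSum a U (fun _ => 1)
        + subsetSum a U f * ((∑ H ∈ X, m H) * subsetSum a U (fun _ => 1)) :=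
        add_le_add (mul_le_mul_of_nonneg_right hd1 hZ) (mul_le_mul_of_nonneg_left hd2 hF)
    _ = _ := by ring

end Decoupling

end FiniteModel

/-! ### Heat kernel bound by Fourier analysis on the torus. -/

section Fourier

open Finset Real UnitAddTorus

/-- The Haar probability measure of the torus. -/
noncomputable def torusHaar (d : ℕ) : Measure (UnitAddTorus (Fin d)) :=
  Measure.pi fun _ => AddCircle.haarAddCircle

instance (d : ℕ) : IsProbabilityMeasure (torusHaar d) := by unfold torusHaar; infer_instance

instance (d : ℕ) : (torusHaar d).IsAddHaarMeasure := by unfold torusHaar; infer_instance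

lemma integral_fourier_haar (n : ℤ) :
    ∫ x : UnitAddCircle, fourier n x ∂AddCircle.haarAddCircle = if n = 0 then 1 else 0 := by
  split_ifs with h
  · simp [h]
  · exact integral_eq_zero_of_add_right_eq_neg (μ := AddCircle.haarAddCircle)
      (fourier_add_half_inv_index h one_pos)

lemma integral_mFourier {d : ℕ} (k : Fin d → ℤ) :
    ∫ θ, mFourier k θ ∂torusHaar d = if k = 0 then 1 else 0 := by
  simp only [mFourier, ContinuousMap.coe_mk, torusHaar]
  rw [integral_fintype_prod_eq_prod (f := fun i (x : UnitAddCircle) => (fourier (k i) x : ℂ))]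
  simp only [integral_fourier_haar]
  by_cases hk : k = 0
  · simp [hk]
  · obtain ⟨i, hi⟩ := Function.ne_iff.1 hk
    rw [if_neg hk]
    exact Finset.prod_eq_zero (mem_univ i) (if_neg hi)

lemma mFourier_eq_fourier_sum {d : ℕ} (k : Fin d → ℤ) (θ : UnitAddTorus (Fin d)) :
    mFourier k θ = fourier 1 (∑ i, k i • θ i) := by
  simp only [mFourier, ContinuousMap.coe_mk]
  have : ∀ s : Finset (Fin d), ∏ i ∈ s, fourier (k i) (θ i) = fourier 1 (∑ i ∈ s, k i • θ i) := by
    intro s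
    induction s using Finset.induction_on with
    | empty => simp
    | insert i s hi ih =>
      rw [prod_insert hi, sum_insert hi, ih]
      simp only [fourier_apply, one_smul, AddCircle.toCircle_add, Circle.coe_mul]
  exact this univ

/-- The endomorphism of the torus given by an integer matrix. -/
noncomputable def torusHom {d : ℕ} (v : Fin d → Fin d → ℤ) :
    UnitAddTorus (Fin d) →+ UnitAddTorus (Fin d) where
  toFun θ j := ∑ i, v j i • θ i
  map_zero' := by ext; simp
  map_add' x y := by ext j; simp [smul_add, Finset.sum_add_distrib]

/-- The real matrix is invertible, so the endomorphism is onto, though not necessarily injective; a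
continuous surjective endomorphism of a compact group preserves Haar measure. -/
lemma measurePreserving_torusHom {d : ℕ} {v : Fin d → Fin d → ℤ}
    (hv : LinearIndependent ℝ fun j i => (v j i : ℝ)) :
    MeasurePreserving (torusHom v) (torusHaar d) (torusHaar d) := by
  refine AddMonoidHom.measurePreserving ?_ ?_ rfl
  · simp only [torusHom, AddMonoidHom.coe_mk, ZeroHom.coe_mk]
    fun_prop
  · intro u
    choose x hx using fun j => QuotientAddGroup.mk_surjective (u j)
    set M : Matrix (Fin d) (Fin d) ℝ := Matrix.of fun j i => (v j i : ℝ) with hM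
    have hu : IsUnit M := Matrix.linearIndependent_rows_iff_isUnit.1 hv
    obtain ⟨y, hy⟩ := (Matrix.mulVec_surjective_iff_isUnit.2 hu) x
    refine ⟨fun i => ((y i : ℝ) : UnitAddCircle), ?_⟩
    funext j
    rw [← hx j, ← hy]
    simp only [torusHom, AddMonoidHom.coe_mk, ZeroHom.coe_mk, Matrix.mulVec, dotProduct, hM,
      Matrix.of_apply]
    have : ((∑ i, (v j i : ℝ) * y i : ℝ) : UnitAddCircle) = ∑ i, v j i • ((y i : ℝ) : UnitAddCircle) := by
      rw [QuotientAddGroup.mk_sum]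
      refine Finset.sum_congr rfl fun i _ => ?_
      rw [← zsmul_eq_mul]
      exact AddCircle.coe_zsmul 1
    exact this.symm

/-- On the fundamental domain `(-1/2, 1/2]` one has `1 - cos (2πx) ≥ 8x²`, which leaves a Gaussian
integral. -/
lemma integral_circle_le {s : ℝ} (hs : 0 < s) :
    ∫ x : UnitAddCircle, exp (-s * (1 - (fourier 1 x : ℂ).re)) ∂AddCircle.haarAddCircle
      ≤ √(π / (8 * s)) := by
  have hvol : (AddCircle.haarAddCircle : Measure UnitAddCircle) = volume := by
    rw [AddCircle.volume_eq_smul_haarAddCircle]; simp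
  rw [hvol, ← UnitAddCircle.integral_preimage (-1 / 2), ← integral_gaussian]
  have hre : ∀ x : ℝ, (fourier 1 (x : UnitAddCircle) : ℂ).re = cos (2 * π * x) := by
    intro x
    rw [fourier_coe_apply]
    have : (2 * π * Complex.I * (1 : ℤ) * x / (1 : ℝ) : ℂ) = ((2 * π * x : ℝ) : ℂ) * Complex.I := by
      push_cast; ring
    rw [this, Complex.exp_ofReal_mul_I_re]
  simp only [hre]
  have hgi : Integrable fun x : ℝ => exp (-(8 * s) * x ^ 2) := integrable_exp_neg_mul_sq (by positivity)
  refine (setIntegral_mono_on ?_ hgi.integrableOn measurableSet_Ioc fun x hx => ?_).trans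
    (setIntegral_le_integral hgi (Filter.Eventually.of_forall fun x => (exp_pos _).le))
  · refine (Continuous.integrableOn_Icc ?_).mono_set Set.Ioc_subset_Icc_self
    fun_prop
  · rw [exp_le_exp]
    have hx' : |2 * π * x| ≤ π := by
      rw [abs_le]
      constructor <;> nlinarith [pi_pos, hx.1, hx.2]
    have h := cos_le_one_sub_mul_cos_sq hx'
    have h2 : 2 / π ^ 2 * (2 * π * x) ^ 2 = 8 * x ^ 2 := by
      field_simp; ring
    rw [h2] at h
    nlinarith

/-- The law at time `t` of the random walk that starts at `0` and whose jumps have the finitely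
supported law `w`. -/
noncomputable def walkKernel {d : ℕ} (A : Finset (Fin d → ℤ)) (w : (Fin d → ℤ) → ℝ) :
    ℕ → (Fin d → ℤ) → ℝ
  | 0, x => if x = 0 then 1 else 0
  | t + 1, x => ∑ a ∈ A, w a * walkKernel A w t (x - a)

/-- The characteristic function of a finitely supported law. -/
noncomputable def charPoly {d : ℕ} (A : Finset (Fin d → ℤ)) (w : (Fin d → ℤ) → ℝ)
    (θ : UnitAddTorus (Fin d)) : ℂ :=
  ∑ a ∈ A, (w a : ℂ) * mFourier a θ

section Kernel

variable {d : ℕ} {A : Finset (Fin d → ℤ)} {w : (Fin d → ℤ) → ℝ}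

lemma continuous_charPoly : Continuous (charPoly A w) := by
  unfold charPoly
  fun_prop

lemma walkKernel_eq_integral (t : ℕ) (x : Fin d → ℤ) :
    (walkKernel A w t x : ℂ) = ∫ θ, charPoly A w θ ^ t * mFourier (-x) θ ∂torusHaar d := by
  induction t generalizing x with
  | zero =>
    simp only [pow_zero, one_mul, integral_mFourier, neg_eq_zero, walkKernel]
    split_ifs <;> simp
  | succ t ih =>
    simp only [walkKernel]
    push_cast
    simp only [ih]
    simp only [← integral_const_mul]
    rw [← integral_finsetSum]
    · refine integral_congr_ae (Filter.Eventually.of_forall fun θ => ?_)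
      simp only
      rw [pow_succ, mul_assoc, mul_comm (charPoly A w θ)]
      have hdef : charPoly A w θ = ∑ a ∈ A, (w a : ℂ) * mFourier a θ := rfl
      conv_rhs => rw [mul_comm (mFourier (-x) θ), hdef, Finset.sum_mul, mul_sum, ← hdef]
      refine Finset.sum_congr rfl fun a _ => ?_
      rw [neg_sub, sub_eq_add_neg, mFourier_add]
      ring
    · intro a _
      refine Continuous.integrable_of_hasCompactSupport ?_ (HasCompactSupport.of_compactSpace _)
      have := continuous_charPoly (A := A) (w := w)
      fun_prop

lemma norm_mFourier (k : Fin d → ℤ) (θ : UnitAddTorus (Fin d)) : ‖mFourier k θ‖ = 1 := by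
  rw [mFourier_eq_fourier_sum, fourier_apply, Circle.norm_coe]

/-- The squared modulus is the characteristic function of the difference of two independent jumps.
Among all pairs of jumps only `(a₀ + v j, a₀)` are kept, each of mass at least `c ^ 2`. -/
lemma sq_norm_charPoly_le (hw : ∀ a ∈ A, 0 ≤ w a) (hsum : ∑ a ∈ A, w a = 1) {a₀ : Fin d → ℤ}
    (ha₀ : a₀ ∈ A) {v : Fin d → Fin d → ℤ} (hv : Function.Injective v)
    (hvA : ∀ j, a₀ + v j ∈ A) {c : ℝ} (hc : 0 ≤ c) (hcw : ∀ a ∈ A, c ≤ w a)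
    (θ : UnitAddTorus (Fin d)) :
    ‖charPoly A w θ‖ ^ 2 ≤ 1 - c ^ 2 * ∑ j, (1 - (fourier 1 (torusHom v θ j) : ℂ).re) := by
  have hre : ∀ k : Fin d → ℤ, (mFourier k θ).re ≤ 1 := fun k =>
    (Complex.re_le_norm _).trans (norm_mFourier k θ).le
  have h1 : ‖charPoly A w θ‖ ^ 2 = ∑ a ∈ A, ∑ b ∈ A, w a * w b * (mFourier (a - b) θ).re := by
    have : ((‖charPoly A w θ‖ ^ 2 : ℝ) : ℂ)
        = ∑ a ∈ A, ∑ b ∈ A, ((w a * w b : ℝ) : ℂ) * mFourier (a - b) θ := by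
      push_cast
      rw [← Complex.mul_conj', charPoly, map_sum, Finset.sum_mul_sum]
      refine Finset.sum_congr rfl fun a _ => Finset.sum_congr rfl fun b _ => ?_
      rw [sub_eq_add_neg, mFourier_add, mFourier_neg, map_mul, Complex.conj_ofReal]
      ring
    have h := congrArg Complex.re this
    rw [Complex.ofReal_re] at h
    rw [h]
    simp only [Complex.re_sum, Complex.re_ofReal_mul]
  have h2 : (1 : ℝ) = ∑ a ∈ A, ∑ b ∈ A, w a * w b := by
    rw [← Finset.sum_mul_sum, hsum, one_mul]
  have h3 : 1 - ‖charPoly A w θ‖ ^ 2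
      = ∑ a ∈ A, ∑ b ∈ A, w a * w b * (1 - (mFourier (a - b) θ).re) := by
    rw [h1]
    simp only [mul_sub, mul_one, Finset.sum_sub_distrib]
    rw [← h2]
  have hnn : ∀ a ∈ A, ∀ b ∈ A, 0 ≤ w a * w b * (1 - (mFourier (a - b) θ).re) :=
    fun a ha b hb => mul_nonneg (mul_nonneg (hw a ha) (hw b hb)) (by linarith [hre (a - b)])
  have h4 : ∑ j, c ^ 2 * (1 - (fourier 1 (torusHom v θ j) : ℂ).re)
      ≤ ∑ a ∈ A, ∑ b ∈ A, w a * w b * (1 - (mFourier (a - b) θ).re) := by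
    calc ∑ j, c ^ 2 * (1 - (fourier 1 (torusHom v θ j) : ℂ).re)
        ≤ ∑ j, ∑ b ∈ A, w (a₀ + v j) * w b * (1 - (mFourier (a₀ + v j - b) θ).re) := by
          refine Finset.sum_le_sum fun j _ => ?_
          refine le_trans ?_ (Finset.single_le_sum (hnn _ (hvA j)) ha₀)
          rw [add_sub_cancel_left, mFourier_eq_fourier_sum, sq]
          refine mul_le_mul_of_nonneg_right
            (mul_le_mul (hcw _ (hvA j)) (hcw _ ha₀) hc (hw _ (hvA j))) ?_
          have := hre (v j)
          rw [mFourier_eq_fourier_sum] at this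
          exact sub_nonneg.2 this
      _ = ∑ a ∈ univ.image fun j => a₀ + v j,
            ∑ b ∈ A, w a * w b * (1 - (mFourier (a - b) θ).re) := by
          rw [Finset.sum_image]
          exact fun i _ j _ h => hv (add_left_cancel h)
      _ ≤ _ := by
          refine Finset.sum_le_sum_of_subset_of_nonneg ?_
            fun a ha _ => Finset.sum_nonneg (hnn a ha)
          intro a ha
          obtain ⟨j, _, rfl⟩ := mem_image.1 ha
          exact hvA j
  rw [← mul_sum] at h4
  linarith

/-- The local central limit bound: a genuinely `d`-dimensional random walk is at a given point at
time `t` with probability `O(t ^ (-d / 2))`. -/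
theorem exists_walkKernel_le (hw : ∀ a ∈ A, 0 < w a) (hsum : ∑ a ∈ A, w a = 1) {a₀ : Fin d → ℤ}
    (ha₀ : a₀ ∈ A) {v : Fin d → Fin d → ℤ} (hv : LinearIndependent ℝ fun j i => (v j i : ℝ))
    (hvA : ∀ j, a₀ + v j ∈ A) :
    ∃ C : ℝ, 0 ≤ C ∧ ∀ t : ℕ, 1 ≤ t → ∀ x, walkKernel A w t x ≤ C * (t : ℝ) ^ (-(d : ℝ) / 2) := by
  have hvi : Function.Injective v := by
    intro i j h
    exact hv.injective (by simp only [h])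
  obtain ⟨a₁, ha₁, hmin⟩ := Finset.exists_min_image A w ⟨a₀, ha₀⟩
  set c := w a₁
  have hc : 0 < c := hw a₁ ha₁
  -- The base is the one-dimensional factor `√(π / (8 * s))` at `s = c ^ 2 * t / 2`, with `t ^
  -- (-1/2)` split off. The half in `s` comes from bounding the square of the modulus.
  refine ⟨√(π / (4 * c ^ 2)) ^ d, by positivity, fun t ht x => ?_⟩
  have ht0 : (0 : ℝ) < t := by exact_mod_cast ht
  set s : ℝ := c ^ 2 * t / 2 with hs
  have hs0 : 0 < s := by positivity
  have hbound : ∀ θ, ‖charPoly A w θ ^ t * mFourier (-x) θ‖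
      ≤ ∏ j, exp (-s * (1 - (fourier 1 (torusHom v θ j) : ℂ).re)) := by
    intro θ
    rw [norm_mul, norm_mFourier, mul_one, norm_pow, ← exp_sum, ← mul_sum]
    have h := sq_norm_charPoly_le (fun a ha => (hw a ha).le) hsum ha₀ hvi hvA hc.le hmin θ
    set D := ∑ j, (1 - (fourier 1 (torusHom v θ j) : ℂ).re)
    have h2 : ‖charPoly A w θ‖ ^ 2 ≤ exp (-(c ^ 2 * D) / 2) ^ 2 := by
      rw [← exp_nat_mul]
      refine h.trans ?_
      have := add_one_le_exp (-(c ^ 2 * D))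
      refine le_trans (by linarith) (this.trans (le_of_eq ?_))
      congr 1
      push_cast
      ring
    have h3 := pow_le_pow_left₀ (norm_nonneg _) (le_of_sq_le_sq h2 (exp_pos _).le) t
    refine h3.trans (le_of_eq ?_)
    rw [← exp_nat_mul, hs]
    congr 1
    ring
  have hle : walkKernel A w t x
      ≤ ∫ θ, ∏ j, exp (-s * (1 - (fourier 1 (θ j) : ℂ).re)) ∂torusHaar d := by
    calc walkKernel A w t x ≤ ‖(walkKernel A w t x : ℂ)‖ := by
          rw [Complex.norm_real]; exact le_abs_self _
      _ ≤ ∫ θ, ∏ j, exp (-s * (1 - (fourier 1 (torusHom v θ j) : ℂ).re)) ∂torusHaar d := by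
          rw [walkKernel_eq_integral]
          refine norm_integral_le_of_norm_le ?_ (Filter.Eventually.of_forall hbound)
          refine Continuous.integrable_of_hasCompactSupport ?_ (HasCompactSupport.of_compactSpace _)
          simp only [torusHom, AddMonoidHom.coe_mk, ZeroHom.coe_mk]
          fun_prop
      _ = _ := by
          -- The substitution needs measure preservation only, so periodicity of the walk is
          -- harmless.
          have hmp := measurePreserving_torusHom hv
          have hcont : Continuous fun θ : UnitAddTorus (Fin d) =>
              ∏ j, exp (-s * (1 - (fourier 1 (θ j) : ℂ).re)) := by fun_prop
          have h := integral_map hmp.measurable.aemeasurable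
            (hcont.aestronglyMeasurable (μ := (torusHaar d).map (torusHom v)))
          rw [hmp.map_eq] at h
          exact h.symm
  refine hle.trans ?_
  rw [torusHaar, integral_fintype_prod_eq_prod
    (f := fun _ (x : UnitAddCircle) => exp (-s * (1 - (fourier 1 x : ℂ).re)))]
  rw [prod_const, card_univ, Fintype.card_fin]
  refine (pow_le_pow_left₀ (integral_nonneg fun _ => (exp_pos _).le)
    (integral_circle_le hs0) d).trans (le_of_eq ?_)
  have h8 : π / (8 * s) = π / (4 * c ^ 2) * (t : ℝ)⁻¹ := by
    rw [hs]; field_simp; norm_num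
  rw [h8, sqrt_mul (by positivity), mul_pow]
  congr 1
  rw [sqrt_eq_rpow, ← rpow_natCast, ← rpow_mul (by positivity), inv_rpow ht0.le, ← rpow_neg ht0.le]
  congr 1
  ring

end Kernel

end Fourier

/-! ### The support of a truly `d`-dimensional jump law. -/

section JumpLaw

open Finset

variable {d : ℕ} {p : PMF (Lattice d)}

/-- The probability of a jump as a real number. -/
noncomputable def jumpProb (p : PMF (Lattice d)) (a : Lattice d) : ℝ := (p a).toReal

lemma jumpProb_pos (hfin : p.support.Finite) {a : Lattice d} (ha : a ∈ hfin.toFinset) :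
    0 < jumpProb p a :=
  ENNReal.toReal_pos ((p.mem_support_iff a).1 (hfin.mem_toFinset.1 ha)) (p.apply_ne_top a)

lemma toMeasure_real_singleton (a : Lattice d) : p.toMeasure.real {a} = jumpProb p a := by
  rw [Measure.real, p.toMeasure_apply_singleton a (measurableSet_singleton a), jumpProb]

lemma ae_mem_support (hfin : p.support.Finite) : ∀ᵐ a ∂p.toMeasure, a ∈ hfin.toFinset := by
  rw [ae_iff, p.toMeasure_apply_eq_zero_iff (MeasurableSet.of_discrete)]
  rw [Set.disjoint_left]
  intro a ha h
  exact h (hfin.mem_toFinset.2 ha)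

lemma integral_toMeasure (hfin : p.support.Finite) (f : Lattice d → ℝ) :
    ∫ a, f a ∂p.toMeasure = ∑ a ∈ hfin.toFinset, jumpProb p a * f a := by
  have hint : Integrable f p.toMeasure := by
    rw [← Measure.restrict_eq_self_of_ae_mem (ae_mem_support hfin)]
    exact IntegrableOn.finset
  rw [PMF.integral_eq_tsum p f hint, tsum_eq_sum (s := hfin.toFinset)]
  · rfl
  · intro a ha
    have : p a = 0 := by
      rw [hfin.mem_toFinset, p.mem_support_iff, not_not] at ha
      exact ha
    simp [this]

lemma sum_jumpProb (hfin : p.support.Finite) : ∑ a ∈ hfin.toFinset, jumpProb p a = 1 := by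
  have := integral_toMeasure hfin fun _ => 1
  simpa using this.symm

/-- If the differences from `a₀` did not span, a nonzero linear functional would be constant on the
support, and the covariance matrix would annihilate its coefficient vector. Hence they span, and a
basis can be extracted from them. -/
lemma exists_linearIndependent_differences (hfin : p.support.Finite) (hdim : TrulyDimensional p) :
    ∃ a₀ ∈ hfin.toFinset, ∃ v : Fin d → Lattice d,
      LinearIndependent ℝ (fun j i => (v j i : ℝ)) ∧ ∀ j, a₀ + v j ∈ hfin.toFinset := by
  obtain ⟨a₀, ha₀⟩ := p.support_nonempty
  have ha₀' := hfin.mem_toFinset.2 ha₀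
  refine ⟨a₀, ha₀', ?_⟩
  set T : Set (Fin d → ℝ) :=
    (fun a : Lattice d => fun i => ((a i - a₀ i : ℤ) : ℝ)) '' hfin.toFinset with hT
  have hspan : Submodule.span ℝ T = ⊤ := by
    by_contra hne
    obtain ⟨f, hf0, hf⟩ := Submodule.exists_le_ker_of_lt_top _ (lt_top_iff_ne_top.2 hne)
    set θ : Fin d → ℝ := fun i => f (Pi.single i 1) with hθ
    have hfθ : ∀ x : Fin d → ℝ, f x = ∑ i, x i * θ i := by
      intro x
      conv_lhs => rw [LinearMap.pi_apply_eq_sum_univ f x]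
      refine Finset.sum_congr rfl fun i _ => ?_
      rw [smul_eq_mul, hθ]
      congr 3
      ext j
      simp [Pi.single_apply, eq_comm]
    have hconst : ∀ a ∈ hfin.toFinset, ∑ i, (a i : ℝ) * θ i = ∑ i, (a₀ i : ℝ) * θ i := by
      intro a ha
      have h1 : f (fun i => ((a i - a₀ i : ℤ) : ℝ)) = 0 :=
        hf (Submodule.subset_span ⟨a, ha, rfl⟩)
      rw [hfθ] at h1
      simp only [Int.cast_sub, sub_mul, Finset.sum_sub_distrib] at h1
      linarith
    have hker : (covMatrix p).mulVec θ = 0 := by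
      funext j
      set m : Fin d → ℝ := fun k => ∫ z : Lattice d, (z k : ℝ) ∂p.toMeasure with hm
      have hmθ : ∑ k, m k * θ k = ∑ i, (a₀ i : ℝ) * θ i := by
        simp only [hm, integral_toMeasure hfin, Finset.sum_mul]
        rw [Finset.sum_comm]
        calc ∑ a ∈ hfin.toFinset, ∑ k, jumpProb p a * (a k : ℝ) * θ k
            = ∑ a ∈ hfin.toFinset, jumpProb p a * ∑ i, (a₀ i : ℝ) * θ i := by
              refine Finset.sum_congr rfl fun a ha => ?_
              rw [← hconst a ha, Finset.mul_sum]
              exact Finset.sum_congr rfl fun k _ => by ring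
          _ = _ := by rw [← Finset.sum_mul, sum_jumpProb, one_mul]
      simp only [Matrix.mulVec, dotProduct, covMatrix, Matrix.of_apply, covariance, Pi.zero_apply]
      simp only [integral_toMeasure hfin (fun ω => _ * _), Finset.sum_mul]
      rw [Finset.sum_comm]
      refine Finset.sum_eq_zero fun a ha => ?_
      calc _ = jumpProb p a * ((a j : ℝ) - m j) * ∑ k, ((a k : ℝ) * θ k - m k * θ k) := by
            rw [Finset.mul_sum]
            exact Finset.sum_congr rfl fun k _ => by ring
        _ = 0 := by
            rw [Finset.sum_sub_distrib, hconst a ha, hmθ, sub_self, mul_zero]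
    have hθ0 : θ = 0 := by
      have hinj := Matrix.mulVec_injective_iff_isUnit.2 hdim
      exact hinj (by rw [hker, Matrix.mulVec_zero])
    apply hf0
    ext x
    rw [hθ0] at hfθ
    simp [hfθ]
  have hrank : Module.finrank ℝ (Submodule.span ℝ T) = d := by rw [hspan]; simp
  have hex := Submodule.exists_fun_fin_finrank_span_eq ℝ T
  rw [hrank] at hex
  obtain ⟨f, hfT, -, hli⟩ := hex
  choose a ha hfa using hfT
  refine ⟨fun j => a j - a₀, ?_, fun j => by simpa using ha j⟩
  have hf : (fun j i => (((a j - a₀) i : ℤ) : ℝ)) = f := funext fun j => hfa j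
  rw [hf]
  exact hli

end JumpLaw

/-! ### The two-sided walk and the independence of its jumps. -/

section Walk

open Finset

variable {d : ℕ} {p : PMF (Lattice d)}

/-- The law of the jumps of a two-sided walk. -/
noncomputable def jumpLaw (p : PMF (Lattice d)) : Measure (ℤ → Lattice d) :=
  Measure.infinitePi fun _ => p.toMeasure

instance : IsProbabilityMeasure (jumpLaw p) := by unfold jumpLaw; infer_instance

/-- The displacement from time `r` to time `t`. -/
noncomputable def disp (ξ : ℤ → Lattice d) (r t : ℤ) : Lattice d :=
  ∑ s ∈ Ico r t, ξ s - ∑ s ∈ Ico t r, ξ s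

lemma disp_self (ξ : ℤ → Lattice d) (r : ℤ) : disp ξ r r = 0 := by simp [disp]

lemma disp_of_le (ξ : ℤ → Lattice d) {r t : ℤ} (h : r ≤ t) : disp ξ r t = ∑ s ∈ Ico r t, ξ s := by
  simp [disp, Ico_eq_empty_of_le h]

lemma disp_add_one (ξ : ℤ → Lattice d) (r t : ℤ) : disp ξ r (t + 1) = disp ξ r t + ξ t := by
  rcases le_or_gt r t with h | h
  · have h1 : Ico r (t + 1) = insert t (Ico r t) := by ext; simp; omega
    rw [disp_of_le ξ h, disp_of_le ξ (by omega), h1, sum_insert (by simp), add_comm]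
  · have h1 : Ico t r = insert t (Ico (t + 1) r) := by ext; simp; omega
    rw [disp, disp, h1, sum_insert (by simp), Ico_eq_empty_of_le h.le,
      Ico_eq_empty_of_le (by omega : t + 1 ≤ r)]
    abel

lemma disp_eq_sub (ξ : ℤ → Lattice d) (r t : ℤ) : disp ξ r t = disp ξ 0 t - disp ξ 0 r := by
  induction t using Int.inductionOn' (b := r) with
  | zero => simp [disp_self]
  | succ k _ ih => rw [disp_add_one, disp_add_one, ih]; abel
  | pred k _ ih =>
    have h1 := disp_add_one ξ r (k - 1)
    have h2 := disp_add_one ξ 0 (k - 1)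
    rw [sub_add_cancel] at h1 h2
    rw [h1, h2] at ih
    rw [← sub_eq_zero] at ih ⊢
    rw [← ih]
    abel

lemma disp_add_disp (ξ : ℤ → Lattice d) (r s t : ℤ) : disp ξ r s + disp ξ s t = disp ξ r t := by
  rw [disp_eq_sub ξ r s, disp_eq_sub ξ s t, disp_eq_sub ξ r t]; abel

/-- The σ-algebra generated by the jumps at the times in `I`. -/
@[reducible]
def jumpsIn (d : ℕ) (I : Set ℤ) : MeasurableSpace (ℤ → Lattice d) :=
  ⨆ i ∈ I, MeasurableSpace.comap (fun ξ => ξ i) inferInstance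

lemma jumpsIn_le (I : Set ℤ) : jumpsIn d I ≤ MeasurableSpace.pi :=
  iSup₂_le fun i _ => (measurable_pi_apply i).comap_le

lemma measurable_jumpsIn_eval {I : Set ℤ} {i : ℤ} (hi : i ∈ I) :
    Measurable[jumpsIn d I] fun ξ : ℤ → Lattice d => ξ i :=
  measurable_iff_comap_le.2
    (le_iSup₂ (f := fun i (_ : i ∈ I) => MeasurableSpace.comap (fun ξ : ℤ → Lattice d => ξ i)
      inferInstance) i hi)

lemma measurable_jumpsIn_disp {I : Set ℤ} {r t : ℤ} (h : ∀ s, (r ≤ s ∧ s < t) ∨ (t ≤ s ∧ s < r) → s ∈ I) :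
    Measurable[jumpsIn d I] fun ξ : ℤ → Lattice d => disp ξ r t := by
  unfold disp
  let _ := jumpsIn d I
  refine Measurable.sub ?_ ?_
  · exact Finset.measurable_fun_sum _ fun s hs => measurable_jumpsIn_eval (h s (Or.inl (mem_Ico.1 hs)))
  · exact Finset.measurable_fun_sum _ fun s hs => measurable_jumpsIn_eval (h s (Or.inr (mem_Ico.1 hs)))

lemma measurable_disp (r t : ℤ) : Measurable fun ξ : ℤ → Lattice d => disp ξ r t :=
  (measurable_jumpsIn_disp (I := Set.univ) fun _ _ => Set.mem_univ _).mono (jumpsIn_le _) le_rfl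

/-- Applied to the times before `r` and the times from `r` on, this is the Markov property at time
`r`. -/
lemma jumpLaw_real_inter {I J : Set ℤ} (hIJ : Disjoint I J) {E F : Set (ℤ → Lattice d)}
    (hE : MeasurableSet[jumpsIn d I] E) (hF : MeasurableSet[jumpsIn d J] F) :
    (jumpLaw p).real (E ∩ F) = (jumpLaw p).real E * (jumpLaw p).real F := by
  have hind : iIndepFun (fun (i : ℤ) (ξ : ℤ → Lattice d) => ξ i) (jumpLaw p) :=
    iIndepFun_infinitePi (P := fun _ : ℤ => p.toMeasure) (X := fun _ x => x) fun _ => measurable_id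
  have h := indep_iSup_of_disjoint (fun i => (measurable_pi_apply i).comap_le) hind hIJ
  rw [Measure.real, (Indep_iff _ _ _).1 h E F hE hF, ENNReal.toReal_mul]
  rfl

lemma jumpLaw_real_eval (i : ℤ) (a : Lattice d) :
    (jumpLaw p).real {ξ | ξ i = a} = jumpProb p a := by
  rw [← toMeasure_real_singleton, ← Measure.infinitePi_map_eval (fun _ : ℤ => p.toMeasure) i,
    map_measureReal_apply (measurable_pi_apply i) (measurableSet_singleton a)]
  rfl

lemma jumpLaw_real_eq_sum (hfin : p.support.Finite) (i : ℤ) {E : Set (ℤ → Lattice d)}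
    (hE : MeasurableSet E) :
    (jumpLaw p).real E = ∑ a ∈ hfin.toFinset, (jumpLaw p).real (E ∩ {ξ | ξ i = a}) := by
  have hm : ∀ a : Lattice d, MeasurableSet {ξ : ℤ → Lattice d | ξ i = a} := fun a =>
    (measurable_pi_apply (X := fun _ : ℤ => Lattice d) i) (measurableSet_singleton a)
  have hae : ∀ᵐ ξ ∂jumpLaw p, ξ i ∈ hfin.toFinset := by
    have h := ae_mem_support hfin
    rw [← Measure.infinitePi_map_eval (fun _ : ℤ => p.toMeasure) i] at h
    exact ae_of_ae_map (measurable_pi_apply i).aemeasurable h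
  rw [← measureReal_biUnion_finset]
  · refine measureReal_congr ?_
    filter_upwards [hae] with ξ hξ
    refine propext ⟨fun h => ?_, fun h => ?_⟩
    · exact Set.mem_biUnion (x := ξ i) hξ ⟨h, rfl⟩
    · obtain ⟨a, _, h⟩ := Set.mem_iUnion₂.1 h
      exact h.1
  · intro a _ b _ hab
    refine Set.disjoint_left.2 fun ξ h h' => hab ?_
    exact h.2.symm.trans h'.2
  · exact fun a _ => hE.inter (hm a)

/-- The law of the sum of the jumps at finitely many times. -/
lemma jumpLaw_real_sum (hfin : p.support.Finite) (s : Finset ℤ) (x : Lattice d) :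
    (jumpLaw p).real {ξ | ∑ i ∈ s, ξ i = x} = walkKernel hfin.toFinset (jumpProb p) #s x := by
  induction s using Finset.induction_on generalizing x with
  | empty =>
    by_cases h : x = 0
    · simp [walkKernel, h]
    · simp [walkKernel, h, Ne.symm h]
  | insert i s hi ih =>
    have hm : ∀ x : Lattice d, MeasurableSet[jumpsIn d s] {ξ : ℤ → Lattice d | ∑ i ∈ s, ξ i = x} := by
      intro x
      let _ := jumpsIn d s
      exact (Finset.measurable_fun_sum _ fun s hs => measurable_jumpsIn_eval hs)
        (measurableSet_singleton x)
    have hm' : ∀ x : Lattice d, MeasurableSet[jumpsIn d {i}] {ξ : ℤ → Lattice d | ξ i = x} :=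
      fun x => measurable_jumpsIn_eval (Set.mem_singleton i) (measurableSet_singleton x)
    have hmi : MeasurableSet {ξ : ℤ → Lattice d | ∑ j ∈ insert i s, ξ j = x} :=
      (Finset.measurable_fun_sum _ fun s _ => measurable_pi_apply s) (measurableSet_singleton x)
    rw [card_insert_of_notMem hi, walkKernel, jumpLaw_real_eq_sum hfin i hmi]
    refine Finset.sum_congr rfl fun a _ => ?_
    rw [← ih, ← jumpLaw_real_eval i a, mul_comm, ← jumpLaw_real_inter _ (hm _) (hm' _)]
    · congr 1
      ext ξ
      simp only [Set.mem_inter_iff, Set.mem_ofPred_eq, sum_insert hi]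
      constructor
      · rintro ⟨h1, h2⟩; exact ⟨by rw [← h1, h2]; abel, h2⟩
      · rintro ⟨h1, h2⟩; exact ⟨by rw [h1, h2]; abel, h2⟩
    · simpa using hi

lemma jumpLaw_real_disp (hfin : p.support.Finite) {r t : ℤ} (h : r ≤ t) (x : Lattice d) :
    (jumpLaw p).real {ξ | disp ξ r t = x}
      = walkKernel hfin.toFinset (jumpProb p) (t - r).toNat x := by
  simp only [disp_of_le _ h]
  rw [jumpLaw_real_sum hfin, Int.card_Ico]

end Walk

/-! ### Uniform escape from a deterministic path. -/

section Escape

open Finset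
open scoped Pointwise

variable {d : ℕ} {p : PMF (Lattice d)}

lemma walkKernel_nonneg {A : Finset (Fin d → ℤ)} {w : (Fin d → ℤ) → ℝ} (hw : ∀ a ∈ A, 0 ≤ w a)
    (t : ℕ) (x : Fin d → ℤ) : 0 ≤ walkKernel A w t x := by
  induction t generalizing x with
  | zero => simp only [walkKernel]; split_ifs <;> norm_num
  | succ t ih => exact Finset.sum_nonneg fun a ha => mul_nonneg (hw a ha) (ih _)

lemma sum_walkKernel_le_one {A : Finset (Fin d → ℤ)} {w : (Fin d → ℤ) → ℝ}
    (hw : ∀ a ∈ A, 0 ≤ w a) (hsum : ∑ a ∈ A, w a = 1) (t : ℕ) (R : Finset (Fin d → ℤ))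
    (z : Fin d → ℤ) : ∑ y ∈ R, walkKernel A w t (z - y) ≤ 1 := by
  induction t generalizing z with
  | zero =>
    simp only [walkKernel, sub_eq_zero, Finset.sum_ite_eq]
    split_ifs <;> norm_num
  | succ t ih =>
    simp only [walkKernel]
    rw [Finset.sum_comm]
    calc ∑ a ∈ A, ∑ y ∈ R, w a * walkKernel A w t (z - y - a)
        = ∑ a ∈ A, w a * ∑ y ∈ R, walkKernel A w t ((z - a) - y) := by
          refine Finset.sum_congr rfl fun a _ => ?_
          rw [mul_sum]
          exact Finset.sum_congr rfl fun y _ => by rw [sub_right_comm]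
      _ ≤ ∑ a ∈ A, w a * 1 :=
          Finset.sum_le_sum fun a ha => mul_le_mul_of_nonneg_left (ih _) (hw a ha)
      _ = 1 := by simp [hsum]

/-- The local central limit bound for the jump law `p`. -/
theorem exists_heatKernel_bound (hfin : p.support.Finite) (hdim : TrulyDimensional p) :
    ∃ C : ℝ, 0 ≤ C ∧ ∀ t : ℕ, 1 ≤ t → ∀ x,
      walkKernel hfin.toFinset (jumpProb p) t x ≤ C * (t : ℝ) ^ (-(d : ℝ) / 2) := by
  obtain ⟨a₀, ha₀, v, hv, hvA⟩ := exists_linearIndependent_differences hfin hdim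
  exact exists_walkKernel_le (fun a ha => jumpProb_pos hfin ha) (sum_jumpProb hfin) ha₀ hv hvA

/-- Three possible jumps let the set of reachable sites keep growing although one site is forbidden
at each step. -/
lemma three_le_card_support (hd : 2 ≤ d) (hfin : p.support.Finite) (hdim : TrulyDimensional p) :
    3 ≤ #hfin.toFinset := by
  obtain ⟨a₀, ha₀, v, hv, hvA⟩ := exists_linearIndependent_differences hfin hdim
  have h0 : ∀ j, v j ≠ 0 := fun j h => hv.ne_zero j (by funext i; simp [h])
  set i : Fin d := ⟨0, by omega⟩
  set j : Fin d := ⟨1, by omega⟩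
  have hij : v i ≠ v j := fun h => by
    have : i = j := hv.injective (by simp only [h])
    simp [i, j] at this
  have hsub : ({a₀, a₀ + v i, a₀ + v j} : Finset (Lattice d)) ⊆ hfin.toFinset := by
    intro a ha
    simp only [mem_insert, mem_singleton] at ha
    rcases ha with rfl | rfl | rfl
    exacts [ha₀, hvA i, hvA j]
  refine le_trans (le_of_eq ?_) (card_le_card hsub)
  rw [card_eq_three.2]
  refine ⟨_, _, _, ?_, ?_, ?_, rfl⟩
  · simpa using h0 i
  · simpa using h0 j
  · simpa using hij

/-- The sites that a walk started at `x` at time `r` can reach in `k` steps while avoiding `γ`. -/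
def reach (A : Finset (Lattice d)) (γ : ℤ → Lattice d) (r : ℤ) (x : Lattice d) :
    ℕ → Finset (Lattice d)
  | 0 => {x}
  | k + 1 => (reach A γ r x k + A).erase (γ (r + k + 1))

/-- By Cauchy–Davenport in a torsion-free group, adding `A` gains at least `#A - 1 ≥ 2` sites, and
the path removes at most one. -/
lemma lt_card_reach {A : Finset (Lattice d)} (hA : 3 ≤ #A) (γ : ℤ → Lattice d) (r : ℤ)
    (x : Lattice d) (k : ℕ) : k < #(reach A γ r x k) := by
  induction k with
  | zero => simp [reach]
  | succ k ih =>
    have h1 := cauchy_davenport_of_isAddTorsionFree (s := reach A γ r x k) (t := A)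
      (card_pos.1 (by omega)) (card_pos.1 (by omega))
    have h2 := pred_card_le_card_erase (s := reach A γ r x k + A) (a := γ (r + k + 1))
    rw [reach]
    omega

lemma measurableSet_jumpsIn_avoid {I : Set ℤ} {r e : ℤ} (hI : Set.Ico r e ⊆ I) (x : Lattice d)
    (γ : ℤ → Lattice d) :
    MeasurableSet[jumpsIn d I] {ξ : ℤ → Lattice d | ∀ t ∈ Ioc r e, x + disp ξ r t ≠ γ t} := by
  have : {ξ : ℤ → Lattice d | ∀ t ∈ Ioc r e, x + disp ξ r t ≠ γ t}
      = ⋂ t ∈ Ioc r e, (fun ξ => disp ξ r t) ⁻¹' {y | x + y ≠ γ t} := by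
    ext ξ; simp
  rw [this]
  let _ := jumpsIn d I
  refine Finset.measurableSet_biInter _ fun t ht => ?_
  rw [mem_Ioc] at ht
  refine measurable_jumpsIn_disp (fun s hs => hI ?_) (MeasurableSet.of_discrete)
  rcases hs with hs | hs
  · exact ⟨hs.1, by omega⟩
  · omega

lemma pow_le_jumpLaw_reach (hfin : p.support.Finite) {c : ℝ} (hc : 0 ≤ c)
    (hcp : ∀ a ∈ hfin.toFinset, c ≤ jumpProb p a) (γ : ℤ → Lattice d) (r : ℤ) (x : Lattice d)
    (k : ℕ) : ∀ y ∈ reach hfin.toFinset γ r x k, c ^ k ≤ (jumpLaw p).real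
      ({ξ | ∀ t ∈ Ioc r (r + k), x + disp ξ r t ≠ γ t} ∩ {ξ | x + disp ξ r (r + k) = y}) := by
  induction k with
  | zero =>
    intro y hy
    rw [reach, mem_singleton] at hy
    simp [hy, disp_self]
  | succ k ih =>
    intro y hy
    rw [reach, mem_erase, mem_add] at hy
    obtain ⟨hyγ, y', hy', a, ha, rfl⟩ := hy
    have hm1 : MeasurableSet[jumpsIn d (Set.Iio (r + k))]
        ({ξ : ℤ → Lattice d | ∀ t ∈ Ioc r (r + k), x + disp ξ r t ≠ γ t}
          ∩ {ξ | x + disp ξ r (r + k) = y'}) := by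
      refine MeasurableSet.inter (measurableSet_jumpsIn_avoid (fun s hs => hs.2) x γ) ?_
      refine measurable_jumpsIn_disp (fun s hs => ?_) (MeasurableSet.of_discrete (s := {z | x + z = y'}))
      rw [Set.mem_Iio]
      omega
    have hm2 : MeasurableSet[jumpsIn d {r + k}] {ξ : ℤ → Lattice d | ξ (r + k) = a} :=
      measurable_jumpsIn_eval (Set.mem_singleton _) (measurableSet_singleton a)
    calc c ^ (k + 1) = c ^ k * c := pow_succ c k
      _ ≤ _ := mul_le_mul (ih y' hy') (hcp a ha) hc measureReal_nonneg
      _ = _ := by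
        rw [← jumpLaw_real_eval (r + k) a, ← jumpLaw_real_inter _ hm1 hm2]
        simp
      _ ≤ _ := by
        refine measureReal_mono ?_
        rintro ξ ⟨⟨h1, h2⟩, h3⟩
        simp only [Set.mem_ofPred_eq] at h2 h3
        have h4 : x + disp ξ r (r + (k + 1 : ℕ)) = y' + a := by
          push_cast
          rw [← add_assoc, disp_add_one, ← add_assoc, h2, h3]
        refine ⟨fun t ht => ?_, h4⟩
        rw [mem_Ioc] at ht
        push_cast at ht h4
        rcases (show t ≤ r + k ∨ t = r + (k + 1) by omega) with h | rfl
        · exact h1 t (mem_Ioc.2 ⟨ht.1, h⟩)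
        · rw [h4, ← add_assoc]
          exact fun h => hyγ h

lemma summable_heatKernel (hd : 3 ≤ d) (C : ℝ) :
    Summable fun t : ℕ => C * (t : ℝ) ^ (-(d : ℝ) / 2) := by
  refine (Real.summable_nat_rpow.2 ?_).mul_left C
  have : (3 : ℝ) ≤ d := by exact_mod_cast hd
  linarith

/-- A walk avoids every deterministic path with probability bounded away from zero. -/
theorem exists_escape_bound (hd : 3 ≤ d) (hfin : p.support.Finite) (hdim : TrulyDimensional p) :
    ∃ δ : ℝ, 0 < δ ∧ ∀ (γ : ℤ → Lattice d) (r e : ℤ) (x : Lattice d),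
      δ ≤ (jumpLaw p).real {ξ | ∀ t ∈ Ioc r e, x + disp ξ r t ≠ γ t} := by
  have hcard := three_le_card_support (by omega) hfin hdim
  obtain ⟨C, hC, hCk⟩ := exists_heatKernel_bound hfin hdim
  set A := hfin.toFinset
  set w := jumpProb p
  have hw : ∀ a ∈ A, 0 ≤ w a := fun a ha => (jumpProb_pos hfin ha).le
  obtain ⟨a₁, ha₁, hmin⟩ := Finset.exists_min_image A w (card_pos.1 (by omega))
  have hc : 0 < w a₁ := jumpProb_pos hfin ha₁
  obtain ⟨s, hs⟩ := summable_iff_vanishing_norm.1 (summable_heatKernel hd C) (1 / 4) (by norm_num)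
  set τ := s.sup id + 1 with hτ
  have htail : ∀ J : ℕ, ∑ j ∈ Ioc τ J, C * (j : ℝ) ^ (-(d : ℝ) / 2) ≤ 1 / 4 := by
    intro J
    refine (le_abs_self _).trans (hs _ ?_).le
    rw [Finset.disjoint_left]
    intro j hj hjs
    have h1 : j ≤ s.sup id := Finset.le_sup (f := id) hjs
    rw [mem_Ioc] at hj
    omega
  clear_value τ
  -- After `K` steps more than `4 * τ` sites are reachable, so a total of `τ` expected visits is at
  -- most a quarter per site; the tail beyond `τ` costs another quarter.
  obtain ⟨K, hK⟩ : ∃ K, K = 4 * τ := ⟨_, rfl⟩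
  refine ⟨w a₁ ^ K * (1 / 2), by positivity, fun γ r e x => ?_⟩
  set R := reach A γ r x K with hR
  have hRcard : K < #R := lt_card_reach hcard γ r x K
  have hRpos : (0 : ℝ) < #R := by exact_mod_cast (by omega : 0 < #R)
  set J := (e - (r + K)).toNat with hJ
  -- Averaging over the starting site `y`: at each of the first `τ` times the hitting probabilities
  -- sum to at most `1` over `y`, however large `R` is, and later times are handled by the heat
  -- kernel. Hence some `y` has at most `1/2` expected visits.
  have hdouble : ∑ y ∈ R, ∑ j ∈ Ioc 0 J, walkKernel A w j (γ (r + K + j) - y)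
      ≤ ∑ y ∈ R, (1 / 2 : ℝ) := by
    have hsub : Ioc 0 J ⊆ Ioc 0 τ ∪ Ioc τ J := by
      intro j hj
      simp only [mem_union, mem_Ioc] at hj ⊢
      omega
    rw [Finset.sum_comm]
    calc ∑ j ∈ Ioc 0 J, ∑ y ∈ R, walkKernel A w j (γ (r + K + j) - y)
        ≤ ∑ j ∈ Ioc 0 τ ∪ Ioc τ J, ∑ y ∈ R, walkKernel A w j (γ (r + K + j) - y) :=
          Finset.sum_le_sum_of_subset_of_nonneg hsub fun j _ _ =>
            Finset.sum_nonneg fun y _ => walkKernel_nonneg hw _ _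
      _ = ∑ j ∈ Ioc 0 τ, ∑ y ∈ R, walkKernel A w j (γ (r + K + j) - y)
          + ∑ j ∈ Ioc τ J, ∑ y ∈ R, walkKernel A w j (γ (r + K + j) - y) := by
          refine Finset.sum_union (Finset.disjoint_left.2 fun j h1 h2 => ?_)
          rw [mem_Ioc] at h1 h2
          omega
      _ ≤ ∑ j ∈ Ioc 0 τ, 1 + ∑ j ∈ Ioc τ J, ∑ y ∈ R, C * (j : ℝ) ^ (-(d : ℝ) / 2) := by
          refine add_le_add (Finset.sum_le_sum fun j _ => sum_walkKernel_le_one hw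
            (sum_jumpProb hfin) _ _ _) (Finset.sum_le_sum fun j hj => Finset.sum_le_sum fun y _ => ?_)
          rw [mem_Ioc] at hj
          exact hCk j (by omega) _
      _ = τ + #R * ∑ j ∈ Ioc τ J, C * (j : ℝ) ^ (-(d : ℝ) / 2) := by
          simp [mul_sum]
      _ ≤ #R * (1 / 4) + #R * (1 / 4) := by
          refine add_le_add ?_ (mul_le_mul_of_nonneg_left (htail J) hRpos.le)
          have : (4 * τ : ℝ) ≤ #R := by exact_mod_cast (by omega : 4 * τ ≤ #R)
          linarith
      _ = ∑ y ∈ R, (1 / 2 : ℝ) := by rw [sum_const, nsmul_eq_mul]; ring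
  obtain ⟨y, hyR, hy⟩ := Finset.exists_le_of_sum_le (card_pos.1 (by omega)) hdouble
  set E₂ : Set (ℤ → Lattice d) := {ξ | ∀ t ∈ Ioc (r + K) e, y + disp ξ (r + K) t ≠ γ t} with hE₂
  have hE₂m : MeasurableSet[jumpsIn d (Set.Ici (r + K))] E₂ :=
    measurableSet_jumpsIn_avoid (fun s hs => hs.1) y γ
  have hE₂p : 1 / 2 ≤ (jumpLaw p).real E₂ := by
    have hcompl : (jumpLaw p).real E₂ᶜ ≤ 1 / 2 := by
      refine le_trans ?_ hy
      have hsub : E₂ᶜ ⊆ ⋃ j ∈ Ioc 0 J,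
          {ξ : ℤ → Lattice d | disp ξ (r + K) (r + K + j) = γ (r + K + j) - y} := by
        intro ξ hξ
        simp only [hE₂, Set.mem_compl_iff, Set.mem_ofPred_eq, not_forall, not_not] at hξ
        obtain ⟨t, ht, h⟩ := hξ
        rw [mem_Ioc] at ht
        have htj : r + K + ((t - (r + K)).toNat : ℤ) = t := by omega
        refine Set.mem_biUnion (x := (t - (r + K)).toNat) ?_ ?_
        · simp only [coe_Ioc, Set.mem_Ioc]; omega
        · simp only [Set.mem_ofPred_eq]
          rw [htj, ← h]; abel
      refine (measureReal_mono hsub (measure_ne_top _ _)).trans ((measureReal_biUnion_finset_le _ _).trans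
        (Finset.sum_le_sum fun j _ => ?_))
      rw [jumpLaw_real_disp hfin (by omega), add_sub_cancel_left, Int.toNat_natCast]
    rw [probReal_compl_eq_one_sub (jumpsIn_le _ _ hE₂m)] at hcompl
    linarith
  have hm1 : MeasurableSet[jumpsIn d (Set.Iio (r + K))]
      ({ξ : ℤ → Lattice d | ∀ t ∈ Ioc r (r + K), x + disp ξ r t ≠ γ t}
        ∩ {ξ | x + disp ξ r (r + K) = y}) := by
    refine MeasurableSet.inter (measurableSet_jumpsIn_avoid (fun s hs => hs.2) x γ) ?_
    refine measurable_jumpsIn_disp (fun s hs => ?_) (MeasurableSet.of_discrete (s := {z | x + z = y}))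
    rw [Set.mem_Iio]
    omega
  calc w a₁ ^ K * (1 / 2)
      ≤ _ := mul_le_mul (pow_le_jumpLaw_reach hfin hc.le hmin γ r x K y hyR) hE₂p (by norm_num)
        measureReal_nonneg
    _ = _ := by
        rw [← jumpLaw_real_inter (Set.Iio_disjoint_Ici le_rfl) hm1 hE₂m]
    _ ≤ _ := by
        refine measureReal_mono ?_
        rintro ξ ⟨⟨h1, h2⟩, h3⟩ t ht
        rw [mem_Ioc] at ht
        rcases le_or_gt t (r + K) with h | h
        · exact h1 t (mem_Ioc.2 ⟨ht.1, h⟩)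
        · have := h3 t (mem_Ioc.2 ⟨h, ht.2⟩)
          rw [← disp_add_disp ξ r (r + K) t, ← add_assoc]
          rwa [← h2] at this

end Escape

/-! ### Intensities of the sets of visits. -/

section Intensity

open Finset

variable {d : ℕ} {p : PMF (Lattice d)}

lemma cast_toNat {m : ℤ} (h : 0 ≤ m) : ((m.toNat : ℕ) : ℝ) = (m : ℝ) := by
  exact_mod_cast congrArg (Int.cast (R := ℝ)) (Int.toNat_of_nonneg h)

lemma sum_biUnion_le_sum {ι κ : Type*} [DecidableEq ι] [DecidableEq κ] (s : Finset κ)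
    (t : κ → Finset ι) {f : ι → ℝ} (hf : ∀ i, 0 ≤ f i) :
    ∑ i ∈ s.biUnion t, f i ≤ ∑ k ∈ s, ∑ i ∈ t k, f i := by
  induction s using Finset.induction_on with
  | empty => simp
  | insert k s hk ih =>
    rw [biUnion_insert, sum_insert hk]
    have h1 := Finset.sum_union_inter (s₁ := t k) (s₂ := s.biUnion t) (f := f)
    have h2 := Finset.sum_nonneg (s := t k ∩ s.biUnion t) fun i _ => hf i
    linarith

/-- The σ-algebra is left arbitrary so that the lemma also applies to the one generated by the jumps
before `r`. -/
lemma measurableSet_filter {Ω : Type*} {m : MeasurableSpace Ω} (T : Finset ℤ) (P : Ω → ℤ → Prop)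
    [∀ ω, DecidablePred (P ω)] (h : ∀ t ∈ T, MeasurableSet {ω | P ω t}) (Q : Finset ℤ → Prop) :
    MeasurableSet {ω | Q (T.filter (P ω))} := by
  induction T using Finset.induction_on generalizing Q with
  | empty => simp
  | insert t T ht ih =>
    have h1 := h t (mem_insert_self t T)
    have ih' := fun Q => ih (fun s hs => h s (mem_insert_of_mem hs)) Q
    have : {ω | Q ((insert t T).filter (P ω))}
        = ({ω | P ω t} ∩ {ω | Q (insert t (T.filter (P ω)))})
          ∪ ({ω | P ω t}ᶜ ∩ {ω | Q (T.filter (P ω))}) := by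
      ext ω
      by_cases hω : P ω t <;> simp [Finset.filter_insert, hω]
    rw [this]
    exact (h1.inter (ih' fun H => Q (insert t H))).union (h1.compl.inter (ih' Q))

/-- The times in `T` at which the walk that is at `x` at time `r` meets `γ`. -/
noncomputable def visits (γ : ℤ → Lattice d) (T : Finset ℤ) (r : ℤ) (x : Lattice d)
    (ξ : ℤ → Lattice d) : Finset ℤ :=
  T.filter fun t => x + disp ξ r t = γ t

lemma mem_visits {γ : ℤ → Lattice d} {T : Finset ℤ} {r : ℤ} {x : Lattice d} {ξ : ℤ → Lattice d}
    {t : ℤ} : t ∈ visits γ T r x ξ ↔ t ∈ T ∧ x + disp ξ r t = γ t := mem_filter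

lemma visits_subset (γ : ℤ → Lattice d) (T : Finset ℤ) (r : ℤ) (x : Lattice d)
    (ξ : ℤ → Lattice d) : visits γ T r x ξ ⊆ T := filter_subset _ _

lemma measurableSet_visits (γ : ℤ → Lattice d) (T : Finset ℤ) (r : ℤ) (x : Lattice d)
    (Q : Finset ℤ → Prop) : MeasurableSet {ξ | Q (visits γ T r x ξ)} :=
  measurableSet_filter T (fun ξ t => x + disp ξ r t = γ t) (fun t _ =>
    measurable_disp r t (MeasurableSet.of_discrete (s := {y | x + y = γ t}))) Q

lemma visits_zero_eq {γ : ℤ → Lattice d} {T : Finset ℤ} {r : ℤ} {z : Lattice d}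
    {ξ : ℤ → Lattice d} (h : z + disp ξ 0 r = γ r) :
    visits γ T 0 z ξ = visits γ T r (γ r) ξ := by
  refine Finset.filter_congr fun t _ => ?_
  rw [← h, add_assoc, disp_add_disp]

/-- The intensity of the walks whose set of visits is `H`. -/
noncomputable def intensity (lam : ℝ≥0) (p : PMF (Lattice d)) (γ : ℤ → Lattice d) (T : Finset ℤ)
    (H : Finset ℤ) : ℝ :=
  lam * (∑' z, jumpLaw p {ξ | visits γ T 0 z ξ = H}).toReal

lemma intensity_nonneg (lam : ℝ≥0) (p : PMF (Lattice d)) (γ : ℤ → Lattice d) (T H : Finset ℤ) :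
    0 ≤ intensity lam p γ T H := by unfold intensity; positivity

/-- Counting measure on the starting sites is invariant under the walk. A trajectory of jumps and
the requirement of being at `γ r` at time `r` determine the starting site, so the events for
different `z` are disjoint and unite to the event for the walk pinned at `γ r`. -/
lemma tsum_visits_eq {γ : ℤ → Lattice d} {T H : Finset ℤ} {r : ℤ} (hr : r ∈ H) :
    ∑' z, jumpLaw p {ξ | visits γ T 0 z ξ = H} = jumpLaw p {ξ | visits γ T r (γ r) ξ = H} := by
  rw [← measure_iUnion]
  · congr 1
    ext ξ
    simp only [Set.mem_iUnion, Set.mem_ofPred_eq]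
    constructor
    · rintro ⟨z, hz⟩
      have h : r ∈ visits γ T 0 z ξ := hz ▸ hr
      rw [← visits_zero_eq (mem_visits.1 h).2, hz]
    · intro h
      refine ⟨γ r - disp ξ 0 r, ?_⟩
      rw [visits_zero_eq (sub_add_cancel _ _), h]
  · intro z z' hzz'
    refine Set.disjoint_left.2 fun ξ h h' => hzz' ?_
    have h1 : r ∈ visits γ T 0 z ξ := (show visits γ T 0 z ξ = H from h) ▸ hr
    have h2 : r ∈ visits γ T 0 z' ξ := (show visits γ T 0 z' ξ = H from h') ▸ hr
    exact add_right_cancel ((mem_visits.1 h1).2.trans (mem_visits.1 h2).2.symm)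
  · exact fun z => measurableSet_visits γ T 0 z (· = H)

lemma intensity_eq {lam : ℝ≥0} {γ : ℤ → Lattice d} {T H : Finset ℤ} {r : ℤ} (hr : r ∈ H) :
    intensity lam p γ T H = lam * (jumpLaw p).real {ξ | visits γ T r (γ r) ξ = H} := by
  rw [intensity, tsum_visits_eq hr, Measure.real]

/-- The nonempty subsets of `T`. -/
def visitSets (T : Finset ℤ) : Finset (Finset ℤ) := T.powerset.erase ∅

lemma mem_visitSets {T H : Finset ℤ} : H ∈ visitSets T ↔ H.Nonempty ∧ H ⊆ T := by
  rw [visitSets, mem_erase, mem_powerset, nonempty_iff_ne_empty]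

/-- The possible sets of visits through `r` partition the trajectories pinned at `γ r`, which turns
sums of intensities into probabilities for a single walk. -/
lemma sum_intensity {lam : ℝ≥0} {γ : ℤ → Lattice d} {T : Finset ℤ} {r : ℤ} (hr : r ∈ T)
    (Q : Finset ℤ → Prop) [DecidablePred Q] :
    ∑ H ∈ visitSets T with r ∈ H ∧ Q H, intensity lam p γ T H
      = lam * (jumpLaw p).real {ξ | Q (visits γ T r (γ r) ξ)} := by
  rw [Finset.sum_congr rfl fun H hH => intensity_eq (mem_filter.1 hH).2.1, ← mul_sum]
  congr 1
  rw [← measureReal_biUnion_finset]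
  · congr 1
    ext ξ
    simp only [Set.mem_iUnion, Set.mem_ofPred_eq, mem_filter, exists_prop, mem_visitSets]
    constructor
    · rintro ⟨H, ⟨_, _, hQ⟩, hH⟩
      rwa [hH]
    · intro h
      have hr' : r ∈ visits γ T r (γ r) ξ := mem_visits.2 ⟨hr, by rw [disp_self, add_zero]⟩
      exact ⟨_, ⟨⟨⟨r, hr'⟩, visits_subset _ _ _ _ _⟩, hr', h⟩, rfl⟩
  · intro H _ H' _ hne
    refine Set.disjoint_left.2 fun ξ h h' => hne ?_
    exact Eq.trans (Eq.symm h) h'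
  · exact fun H _ => measurableSet_visits γ T r (γ r) (· = H)

lemma before_visits (γ : ℤ → Lattice d) {Tp T : Finset ℤ} (hT : Tp ⊆ T) (r : ℤ)
    (ξ : ℤ → Lattice d) : before Tp r (visits γ T r (γ r) ξ)
      = (Tp.filter (· < r)).filter fun t => γ r + disp ξ r t = γ t := by
  ext t
  simp only [before, mem_filter, mem_inter, mem_visits]
  have := @hT t
  tauto

lemma measurableSet_before (γ : ℤ → Lattice d) {Tp T : Finset ℤ} (hT : Tp ⊆ T) (r : ℤ)
    (b : Finset ℤ) : MeasurableSet[jumpsIn d (Set.Iio r)]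
      {ξ | before Tp r (visits γ T r (γ r) ξ) = b} := by
  simp only [before_visits γ hT]
  refine measurableSet_filter (m := jumpsIn d (Set.Iio r)) _
    (fun ξ t => γ r + disp ξ r t = γ t) (fun t ht => ?_) (· = b)
  rw [mem_filter] at ht
  refine measurable_jumpsIn_disp (fun s hs => ?_) (MeasurableSet.of_discrete (s := {y | γ r + y = γ t}))
  rw [Set.mem_Iio]
  omega

/-- A bound for the expected number of visits to `Tf` of a walk that is on the path at time `r`. -/
noncomputable def hitBound (d : ℕ) (C : ℝ) (Tf : Finset ℤ) (r : ℤ) : ℝ :=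
  ∑ t ∈ Tf, C * ((t - r : ℤ) : ℝ) ^ (-(d : ℝ) / 2)

lemma measurableSet_hit (γ : ℤ → Lattice d) {Tf : Finset ℤ} {r : ℤ} (h : ∀ t ∈ Tf, r < t) :
    MeasurableSet[jumpsIn d (Set.Ici r)] {ξ | ∃ t ∈ Tf, γ r + disp ξ r t = γ t} := by
  have : {ξ : ℤ → Lattice d | ∃ t ∈ Tf, γ r + disp ξ r t = γ t}
      = ⋃ t ∈ Tf, (fun ξ => disp ξ r t) ⁻¹' {y | γ r + y = γ t} := by
    ext ξ; simp
  rw [this]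
  let _ := jumpsIn d (Set.Ici r)
  refine Finset.measurableSet_biUnion _ fun t ht => ?_
  refine measurable_jumpsIn_disp (fun s hs => ?_) (MeasurableSet.of_discrete)
  have := h t ht
  rw [Set.mem_Ici]
  omega

lemma jumpLaw_real_hit_le (hfin : p.support.Finite) {C : ℝ}
    (hC : ∀ t : ℕ, 1 ≤ t → ∀ x,
      walkKernel hfin.toFinset (jumpProb p) t x ≤ C * (t : ℝ) ^ (-(d : ℝ) / 2))
    (γ : ℤ → Lattice d) {Tf : Finset ℤ} {r : ℤ} (h : ∀ t ∈ Tf, r < t) :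
    (jumpLaw p).real {ξ | ∃ t ∈ Tf, γ r + disp ξ r t = γ t} ≤ hitBound d C Tf r := by
  have hsub : {ξ : ℤ → Lattice d | ∃ t ∈ Tf, γ r + disp ξ r t = γ t}
      ⊆ ⋃ t ∈ Tf, {ξ | disp ξ r t = γ t - γ r} := by
    rintro ξ ⟨t, ht, hξ⟩
    refine Set.mem_biUnion (x := t) ht ?_
    simp only [Set.mem_ofPred_eq, ← hξ, add_sub_cancel_left]
  refine (measureReal_mono hsub (measure_ne_top _ _)).trans
    ((measureReal_biUnion_finset_le _ _).trans (Finset.sum_le_sum fun t ht => ?_))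
  have htr := h t ht
  rw [jumpLaw_real_disp hfin htr.le]
  refine (hC _ (by omega) _).trans (le_of_eq ?_)
  rw [cast_toNat (by omega)]

variable {lam : ℝ≥0} {C δ : ℝ} {Tp Tf : Finset ℤ}

/-- The intensities of the sets of visits of the field of walks satisfy the hypotheses of the
finite model. -/
theorem intensityBounds (hfin : p.support.Finite) (hC0 : 0 ≤ C)
    (hC : ∀ t : ℕ, 1 ≤ t → ∀ x,
      walkKernel hfin.toFinset (jumpProb p) t x ≤ C * (t : ℝ) ^ (-(d : ℝ) / 2))
    (hδ : 0 < δ) (hesc : ∀ (γ : ℤ → Lattice d) (r e : ℤ) (x : Lattice d),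
      δ ≤ (jumpLaw p).real {ξ | ∀ t ∈ Ioc r e, x + disp ξ r t ≠ γ t})
    (γ : ℤ → Lattice d) (hpf : ∀ r ∈ Tp, ∀ t ∈ Tf, r < t) :
    IntensityBounds (visitSets (Tp ∪ Tf)) Tp Tf (intensity lam p γ (Tp ∪ Tf)) lam δ
      (hitBound d C Tf)
      (fun r b => lam * (jumpLaw p).real {ξ | before Tp r (visits γ (Tp ∪ Tf) r (γ r) ξ) = b}) where
  nonneg := intensity_nonneg lam p γ _
  pos := hδ
  total r hr := by
    have := sum_intensity (p := p) (lam := lam) (γ := γ) (mem_union_left Tf hr) (fun _ => True)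
    simp only [and_true] at this
    rw [this]
    simp
  hit_nonneg r hr := Finset.sum_nonneg fun t ht => mul_nonneg hC0 (Real.rpow_nonneg (by
    have := hpf r hr t ht
    exact_mod_cast (by omega : 0 ≤ t - r)) _)
  hit r hr b _ := by
    rw [sum_intensity (mem_union_left Tf hr)]
    have hsub : {ξ | before Tp r (visits γ (Tp ∪ Tf) r (γ r) ξ) = b
          ∧ (visits γ (Tp ∪ Tf) r (γ r) ξ ∩ Tf).Nonempty}
        ⊆ {ξ | before Tp r (visits γ (Tp ∪ Tf) r (γ r) ξ) = b}
          ∩ {ξ | ∃ t ∈ Tf, γ r + disp ξ r t = γ t} := by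
      rintro ξ ⟨h1, t, ht⟩
      rw [mem_inter, mem_visits] at ht
      exact ⟨h1, t, ht.2, ht.1.2⟩
    have h1 := measureReal_mono (μ := jumpLaw p) hsub (measure_ne_top _ _)
    rw [jumpLaw_real_inter (Set.Iio_disjoint_Ici le_rfl) (measurableSet_before γ subset_union_left r b)
      (measurableSet_hit γ (hpf r hr))] at h1
    have h2 := jumpLaw_real_hit_le hfin hC γ (hpf r hr)
    rw [mul_comm (hitBound d C Tf r), mul_assoc]
    exact mul_le_mul_of_nonneg_left
      (h1.trans (mul_le_mul_of_nonneg_left h2 measureReal_nonneg)) lam.2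
  escape r hr b hb := by
    have hfil : (visitSets (Tp ∪ Tf)).filter (fun H => H ∩ Tp = insert r b)
        = (visitSets (Tp ∪ Tf)).filter (fun H => r ∈ H ∧ H ∩ Tp = insert r b) := by
      refine Finset.filter_congr fun H _ => ⟨fun h => ⟨?_, h⟩, fun h => h.2⟩
      have : r ∈ H ∩ Tp := by rw [h]; exact mem_insert_self r b
      exact (mem_inter.1 this).1
    rw [hfil, sum_intensity (mem_union_left Tf hr)]
    -- Avoiding the path from `r` up to the last past time `e` leaves no past visit after `r`. This
    -- depends on the jumps from `r` on, while the visits before `r` depend on the jumps before `r`.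
    obtain ⟨e, he⟩ : ∃ e, ∀ t ∈ Tp, t ≤ e := ⟨Tp.max' ⟨r, hr⟩, Tp.le_max'⟩
    have hsub : {ξ | before Tp r (visits γ (Tp ∪ Tf) r (γ r) ξ) = b}
        ∩ {ξ | ∀ t ∈ Ioc r e, γ r + disp ξ r t ≠ γ t}
        ⊆ {ξ | visits γ (Tp ∪ Tf) r (γ r) ξ ∩ Tp = insert r b} := by
      rintro ξ ⟨h1, h2⟩
      simp only [Set.mem_ofPred_eq] at h1 ⊢
      rw [← h1]
      ext t
      simp only [before, mem_inter, mem_insert, mem_filter, mem_visits, mem_union]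
      constructor
      · rintro ⟨⟨_, h⟩, ht⟩
        rcases lt_trichotomy t r with h3 | h3 | h3
        · exact Or.inr ⟨⟨⟨Or.inl ht, h⟩, ht⟩, h3⟩
        · exact Or.inl h3
        · exact absurd h (h2 t (mem_Ioc.2 ⟨h3, he t ht⟩))
      · rintro (rfl | h)
        · exact ⟨⟨Or.inl hr, by rw [disp_self, add_zero]⟩, hr⟩
        · exact h.1
    have h1 := measureReal_mono (μ := jumpLaw p) hsub (measure_ne_top _ _)
    rw [jumpLaw_real_inter (Set.Iio_disjoint_Ici le_rfl) (measurableSet_before γ subset_union_left r b)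
      (measurableSet_jumpsIn_avoid (fun s hs => hs.1) (γ r) γ)] at h1
    rw [← mul_assoc, mul_comm δ, mul_assoc, mul_comm δ]
    exact mul_le_mul_of_nonneg_left
      ((mul_le_mul_of_nonneg_left (hesc γ r e (γ r)) measureReal_nonneg).trans h1) lam.2

lemma sum_crossing_le (hfin : p.support.Finite)
    (hC : ∀ t : ℕ, 1 ≤ t → ∀ x,
      walkKernel hfin.toFinset (jumpProb p) t x ≤ C * (t : ℝ) ^ (-(d : ℝ) / 2))
    (γ : ℤ → Lattice d) (hpf : ∀ r ∈ Tp, ∀ t ∈ Tf, r < t) :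
    ∑ H ∈ crossing (visitSets (Tp ∪ Tf)) Tp Tf, intensity lam p γ (Tp ∪ Tf) H
      ≤ lam * ∑ r ∈ Tp, hitBound d C Tf r := by
  have hsub : crossing (visitSets (Tp ∪ Tf)) Tp Tf
      ⊆ Tp.biUnion fun r => (visitSets (Tp ∪ Tf)).filter fun H => r ∈ H ∧ (H ∩ Tf).Nonempty := by
    intro H hH
    simp only [crossing, mem_filter] at hH
    obtain ⟨hU, ⟨r, hr⟩, hf⟩ := hH
    rw [mem_inter] at hr
    exact mem_biUnion.2 ⟨r, hr.2, mem_filter.2 ⟨hU, hr.1, hf⟩⟩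
  have hn := intensity_nonneg lam p γ (Tp ∪ Tf)
  refine (Finset.sum_le_sum_of_subset_of_nonneg hsub fun H _ _ => hn H).trans
    ((sum_biUnion_le_sum Tp _ hn).trans ?_)
  rw [mul_sum]
  refine Finset.sum_le_sum fun r hr => ?_
  rw [sum_intensity (mem_union_left Tf hr)]
  refine mul_le_mul_of_nonneg_left (le_trans (measureReal_mono ?_ (measure_ne_top _ _))
    (jumpLaw_real_hit_le hfin hC γ (hpf r hr))) lam.2
  rintro ξ ⟨t, ht⟩
  rw [mem_inter, mem_visits] at ht
  exact ⟨t, ht.2, ht.1.2⟩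

end Intensity

/-! ### The double power sum. -/

section PowerSums

open Finset

/-- Tails of the series `∑ j ^ (-s)`. -/
lemma sum_rpow_neg_le {s : ℝ} (hs : 1 < s) {k : ℕ} (hk : 1 ≤ k) (F : Finset ℕ)
    (hF : ∀ j ∈ F, k ≤ j) :
    ∑ j ∈ F, (j : ℝ) ^ (-s) ≤ (1 + 1 / (s - 1)) * (k : ℝ) ^ (1 - s) := by
  have hk0 : (0 : ℝ) < k := by exact_mod_cast hk
  -- The maximum guarantees `k ≤ N` when `F` is empty, its supremum then being `0`.
  set N := max k (F.sup id) with hN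
  have hkN : k ≤ N := le_max_left _ _
  have hN0 : (0 : ℝ) < N := by exact_mod_cast (by omega : 0 < N)
  have hsub : F ⊆ insert k ((Ico k N).image Nat.succ) := by
    intro j hj
    have h1 := hF j hj
    have h2 : j ≤ F.sup id := Finset.le_sup (f := id) hj
    have h3 : F.sup id ≤ N := le_max_right _ _
    rw [mem_insert, mem_image]
    rcases h1.eq_or_lt with h | h
    · exact Or.inl h.symm
    · exact Or.inr ⟨j - 1, mem_Ico.2 ⟨by omega, by omega⟩, by omega⟩
  have hanti : AntitoneOn (fun x : ℝ => x ^ (-s)) (Set.Icc (k : ℝ) N) := by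
    intro x hx y _ hxy
    exact Real.rpow_le_rpow_of_nonpos (hk0.trans_le hx.1) hxy (by linarith)
  have hint := AntitoneOn.sum_le_integral_Ico hkN hanti
  rw [integral_rpow (Or.inr ⟨by linarith, fun h => by
    rw [Set.uIcc_of_le (by exact_mod_cast hkN)] at h
    exact absurd h.1 (not_le.2 hk0)⟩)] at hint
  have hs1 : 0 < s - 1 := by linarith
  have hle : ((N : ℝ) ^ (-s + 1) - (k : ℝ) ^ (-s + 1)) / (-s + 1) ≤ 1 / (s - 1) * (k : ℝ) ^ (1 - s) := by
    have h1 : (-s + 1) = -(s - 1) := by ring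
    have h2 : (1 - s) = -(s - 1) := by ring
    rw [h1, h2, div_neg, ← neg_div, neg_sub, one_div_mul_eq_div]
    gcongr
    linarith [Real.rpow_nonneg hN0.le (-(s - 1))]
  calc ∑ j ∈ F, (j : ℝ) ^ (-s) ≤ ∑ j ∈ insert k ((Ico k N).image Nat.succ), ((j : ℕ) : ℝ) ^ (-s) :=
        Finset.sum_le_sum_of_subset_of_nonneg hsub fun j _ _ => by positivity
    _ ≤ (k : ℝ) ^ (-s) + ∑ j ∈ (Ico k N).image Nat.succ, (j : ℝ) ^ (-s) := by
        rw [sum_insert]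
        simp only [mem_image, mem_Ico, not_exists, not_and]
        omega
    _ = (k : ℝ) ^ (-s) + ∑ j ∈ Ico k N, ((j + 1 : ℕ) : ℝ) ^ (-s) := by
        rw [sum_image fun a _ b _ h => Nat.succ_injective h]
    _ ≤ (k : ℝ) ^ (1 - s) + 1 / (s - 1) * (k : ℝ) ^ (1 - s) := by
        refine add_le_add ?_ (hint.trans hle)
        exact Real.rpow_le_rpow_of_exponent_le (by exact_mod_cast hk) (by linarith)
    _ = _ := by ring

/-- The double sum that bounds the expected number of walks that visit the path both before time
`0` and after time `n`. -/
theorem exists_sum_hitBound_le {d : ℕ} (hd : 5 ≤ d) {C : ℝ} (hC : 0 ≤ C) :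
    ∃ C' : ℝ, 0 ≤ C' ∧ ∀ (n : ℕ), 1 ≤ n → ∀ Tp Tf : Finset ℤ, (∀ r ∈ Tp, r ≤ 0) →
      (∀ t ∈ Tf, (n : ℤ) ≤ t) →
      ∑ r ∈ Tp, hitBound d C Tf r ≤ C' * (n : ℝ) ^ (-(d : ℝ) / 2 + 2) := by
  have hd' : (5 : ℝ) ≤ d := by exact_mod_cast hd
  set s : ℝ := (d : ℝ) / 2 with hs
  have hs1 : 0 < s - 1 := by linarith
  -- Summability of the outer series requires `d > 4`; the inner one only needs `d > 2`.
  have hs2 : 0 < s - 1 - 1 := by linarith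
  refine ⟨C * ((1 + 1 / (s - 1)) * (1 + 1 / (s - 1 - 1))), by positivity,
    fun n hn Tp Tf hTp hTf => ?_⟩
  have hinner : ∀ r ∈ Tp, hitBound d C Tf r
      ≤ C * (1 + 1 / (s - 1)) * (((n - r).toNat : ℕ) : ℝ) ^ (-(s - 1)) := by
    intro r hr
    have hr0 := hTp r hr
    rw [hitBound, ← mul_sum, mul_assoc]
    refine mul_le_mul_of_nonneg_left ?_ hC
    have hinj : Set.InjOn (fun t : ℤ => (t - r).toNat) Tf := by
      intro t ht t' ht' h
      have h1 := hTf t ht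
      have h2 := hTf t' ht'
      simp only at h
      omega
    have h := sum_rpow_neg_le (s := s) (by linarith) (k := (n - r).toNat) (by omega)
      (Tf.image fun t => (t - r).toNat) (by
        intro j hj
        obtain ⟨t, ht, rfl⟩ := mem_image.1 hj
        have := hTf t ht
        omega)
    rw [sum_image hinj] at h
    rw [neg_sub]
    refine le_trans (le_of_eq (Finset.sum_congr rfl fun t ht => ?_)) h
    have h1 := hTf t ht
    rw [cast_toNat (by omega), hs, neg_div]
  refine (Finset.sum_le_sum hinner).trans ?_
  rw [← mul_sum, mul_assoc, mul_assoc, mul_assoc]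
  refine mul_le_mul_of_nonneg_left (mul_le_mul_of_nonneg_left ?_ (by positivity)) hC
  have hinj : Set.InjOn (fun r : ℤ => (n - r).toNat) Tp := by
    intro r hr r' hr' h
    have h1 := hTp r hr
    have h2 := hTp r' hr'
    simp only at h
    omega
  have h := sum_rpow_neg_le (s := s - 1) (by linarith) (k := n) hn
    (Tp.image fun r => ((n : ℤ) - r).toNat) (by
      intro j hj
      obtain ⟨r, hr, rfl⟩ := mem_image.1 hj
      have := hTp r hr
      omega)
  rw [sum_image hinj] at h
  refine h.trans (le_of_eq ?_)
  congr 2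
  rw [hs]; ring

end PowerSums

/-! ### Void probabilities of the Poisson field. -/

section VoidProbabilities

open Finset

variable {d : ℕ} {p : PMF (Lattice d)}

/-- The walks of distinct particles are independent. -/
lemma infinitePi_forall_particles (Λ : Finset (Lattice d)) (N : Lattice d → ℕ) (S : Lattice d → Set (ℤ → Lattice d))
    (hS : ∀ z, MeasurableSet (S z)) :
    (Measure.infinitePi fun _ : Lattice d × ℕ × ℤ => p.toMeasure)
      {x | ∀ z ∈ Λ, ∀ i < N z, (fun s => x (z, i, s)) ∈ S z} = ∏ z ∈ Λ, jumpLaw p (S z) ^ N z := by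
  have inner : ∀ z, (Measure.infinitePi fun _ : ℕ × ℤ => p.toMeasure)
      {y | ∀ i < N z, (fun s => y (i, s)) ∈ S z} = jumpLaw p (S z) ^ N z := by
    intro z
    have h1 := Measure.infinitePi_map_curry (fun (_ : ℕ) (_ : ℤ) => p.toMeasure)
    have h2 := Measure.infinitePi_pi (fun _ : ℕ => jumpLaw p) (s := range (N z))
      (t := fun _ => S z) fun _ _ => hS z
    rw [prod_const, card_range] at h2
    rw [← h2]
    unfold jumpLaw
    rw [← h1, Measure.map_apply (MeasurableEquiv.measurable _)
      (MeasurableSet.pi (Set.to_countable _) fun _ _ => hS z)]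
    congr 1
    ext y
    simp only [Set.mem_preimage, Set.mem_pi, coe_range, Set.mem_Iio]
    rfl
  have h1 := Measure.infinitePi_map_curry (fun (_ : Lattice d) (_ : ℕ × ℤ) => p.toMeasure)
  have hm : ∀ z, MeasurableSet {y : ℕ × ℤ → Lattice d | ∀ i < N z, (fun s => y (i, s)) ∈ S z} := by
    intro z
    simp only [Set.ofPred_forall]
    refine MeasurableSet.iInter fun i => MeasurableSet.iInter fun _ => ?_
    exact (measurable_pi_lambda _ fun s => measurable_pi_apply (i, s)) (hS z)
  have h2 := Measure.infinitePi_pi (fun _ : Lattice d => Measure.infinitePi fun _ : ℕ × ℤ => p.toMeasure)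
    (s := Λ) (t := fun z => {y | ∀ i < N z, (fun s => y (i, s)) ∈ S z}) fun z _ => hm z
  simp only [inner] at h2
  rw [← h2, ← h1, Measure.map_apply (MeasurableEquiv.measurable _)
      (MeasurableSet.pi (Set.to_countable _) fun z _ => hm z)]
  congr 1

/-- The Poisson generating function: if one walk is good with probability `g`, this is the
probability that all walks from a site are good. -/
lemma lintegral_pow_poisson (lam : ℝ≥0) {g : ℝ} (hg : 0 ≤ g) :
    ∫⁻ k, ENNReal.ofReal g ^ k ∂poissonMeasure lam = ENNReal.ofReal (Real.exp (-lam * (1 - g))) := by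
  rw [poissonMeasure, lintegral_sum_measure]
  simp only [lintegral_smul_measure, lintegral_dirac]
  have h : HasSum (fun k : ℕ => Real.exp (-lam) * lam ^ k / k.factorial * g ^ k)
      (Real.exp (-lam * (1 - g))) := by
    have h1 := (NormedSpace.expSeries_div_hasSum_exp (𝔸 := ℝ) (lam * g)).mul_left (Real.exp (-lam))
    rw [← Real.exp_eq_exp_ℝ, ← Real.exp_add] at h1
    have h2 : -(lam : ℝ) * (1 - g) = -lam + lam * g := by ring
    rw [h2]
    have h3 : (fun k : ℕ => Real.exp (-lam) * lam ^ k / k.factorial * g ^ k)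
        = fun k : ℕ => Real.exp (-lam) * ((lam * g) ^ k / k.factorial) := by
      funext k; rw [mul_pow]; field_simp
    rw [h3]
    exact h1
  rw [← h.tsum_eq, ENNReal.ofReal_tsum_of_nonneg (fun k => by positivity) h.summable]
  congr 1
  funext k
  rw [smul_eq_mul, ENNReal.ofReal_mul (by positivity), ENNReal.ofReal_pow hg]

/-- The jumps of the `i`-th particle of the site `z`. -/
def particleJumps (w : Sample d) (z : Lattice d) (i : ℕ) : ℤ → Lattice d := fun s => w.2 (z, i, s)

lemma measurable_particleJumps (z : Lattice d) (i : ℕ) :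
    Measurable fun w : Sample d => particleJumps w z i :=
  measurable_pi_lambda _ fun s => (measurable_pi_apply (z, i, s)).comp measurable_snd

lemma measurableSet_forall_particles (Λ : Set (Lattice d)) {S : Lattice d → Set (ℤ → Lattice d)}
    (hS : ∀ z, MeasurableSet (S z)) :
    MeasurableSet {w : Sample d | ∀ z ∈ Λ, ∀ i < w.1 z, particleJumps w z i ∈ S z} := by
  have : {w : Sample d | ∀ z ∈ Λ, ∀ i < w.1 z, particleJumps w z i ∈ S z}
      = ⋂ z ∈ Λ, ⋂ i : ℕ, ({w : Sample d | i < w.1 z}ᶜ ∪ {w | particleJumps w z i ∈ S z}) := by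
    ext w
    simp only [Set.mem_ofPred_eq, Set.mem_iInter, Set.mem_union, Set.mem_compl_iff,
      imp_iff_not_or]
  rw [this]
  refine MeasurableSet.biInter (Set.to_countable _) fun z _ => MeasurableSet.iInter fun i => ?_
  refine MeasurableSet.union (MeasurableSet.compl ?_) (measurable_particleJumps z i (hS z))
  exact ((measurable_pi_apply z).comp measurable_fst) (MeasurableSet.of_discrete (s := {k | i < k}))

/-- Given the particle numbers, site `z` contributes the power `N z` of the probability of `S z`;
averaging over the independent Poisson numbers gives a product of exponentials. -/
lemma law_forall_particles_finset (lam : ℝ≥0) (Λ : Finset (Lattice d))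
    {S : Lattice d → Set (ℤ → Lattice d)} (hS : ∀ z, MeasurableSet (S z)) :
    law lam p {w | ∀ z ∈ Λ, ∀ i < w.1 z, particleJumps w z i ∈ S z}
      = ENNReal.ofReal (Real.exp (-lam * ∑ z ∈ Λ, (jumpLaw p).real (S z)ᶜ)) := by
  have hm := measurableSet_forall_particles (Λ : Set (Lattice d)) hS
  simp only [mem_coe] at hm
  rw [law, Measure.prod_apply hm]
  have hsec : ∀ N : Lattice d → ℕ, (Measure.infinitePi fun _ : Lattice d × ℕ × ℤ => p.toMeasure)
      (Prod.mk N ⁻¹' {w : Sample d | ∀ z ∈ Λ, ∀ i < w.1 z, particleJumps w z i ∈ S z})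
      = ∏ z ∈ Λ, ENNReal.ofReal ((jumpLaw p).real (S z)) ^ N z := by
    intro N
    refine (infinitePi_forall_particles Λ N S hS).trans (Finset.prod_congr rfl fun z _ => ?_)
    rw [ofReal_measureReal]
  simp only [hsec]
  have hind : iIndepFun (fun (z : Lattice d) (N : Lattice d → ℕ) =>
      ENNReal.ofReal ((jumpLaw p).real (S z)) ^ N z)
      (Measure.infinitePi fun _ : Lattice d => poissonMeasure lam) :=
    iIndepFun_infinitePi (P := fun _ : Lattice d => poissonMeasure lam)
      (X := fun z k => ENNReal.ofReal ((jumpLaw p).real (S z)) ^ k) fun z => measurable_of_countable _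
  rw [lintegral_prod_eq_prod_lintegral_of_indepFun Λ _ hind
    fun z => (measurable_of_countable fun k : ℕ => ENNReal.ofReal ((jumpLaw p).real (S z)) ^ k).comp
      (measurable_pi_apply z), mul_sum, Real.exp_sum, ENNReal.ofReal_prod_of_nonneg
      fun _ _ => (Real.exp_pos _).le]
  refine Finset.prod_congr rfl fun z _ => ?_
  have := lintegral_map (μ := Measure.infinitePi fun _ : Lattice d => poissonMeasure lam)
    (measurable_of_countable fun k : ℕ => ENNReal.ofReal ((jumpLaw p).real (S z)) ^ k)
    (measurable_pi_apply z)
  rw [Measure.infinitePi_map_eval] at this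
  rw [← this, lintegral_pow_poisson lam measureReal_nonneg, probReal_compl_eq_one_sub (hS z)]

/-- The probability that the walks of all particles lie in given sets. -/
lemma law_forall_particles (lam : ℝ≥0) {S : Lattice d → Set (ℤ → Lattice d)}
    (hS : ∀ z, MeasurableSet (S z)) {h : ℝ} (hh : HasSum (fun z => (jumpLaw p).real (S z)ᶜ) h) :
    (law lam p).real {w | ∀ z, ∀ i < w.1 z, particleJumps w z i ∈ S z} = Real.exp (-lam * h) := by
  set E : Finset (Lattice d) → Set (Sample d) :=
    fun Λ => {w | ∀ z ∈ Λ, ∀ i < w.1 z, particleJumps w z i ∈ S z} with hE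
  have hEm : ∀ Λ, MeasurableSet (E Λ) := fun Λ => by
    have := measurableSet_forall_particles (Λ : Set (Lattice d)) hS
    simpa only [mem_coe] using this
  have hinter : {w : Sample d | ∀ z, ∀ i < w.1 z, particleJumps w z i ∈ S z} = ⋂ Λ, E Λ := by
    ext w
    simp only [hE, Set.mem_ofPred_eq, Set.mem_iInter]
    exact ⟨fun h Λ z _ => h z, fun h z => h {z} z (mem_singleton_self z)⟩
  -- Continuity from above along the finite sets of sites.
  have h1 := tendsto_measure_iInter_atTop (μ := law lam p) (fun Λ => (hEm Λ).nullMeasurableSet)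
    (fun Λ Λ' hΛ w hw z hz => hw z (Finset.mem_of_subset hΛ hz)) ⟨∅, measure_ne_top _ _⟩
  rw [← hinter] at h1
  have h2 := (ENNReal.tendsto_toReal (measure_ne_top _ _)).comp h1
  have h3 : Filter.Tendsto (fun Λ : Finset (Lattice d) =>
      Real.exp (-lam * ∑ z ∈ Λ, (jumpLaw p).real (S z)ᶜ)) Filter.atTop
      (nhds (Real.exp (-lam * h))) :=
    (Real.continuous_exp.tendsto _).comp (Filter.Tendsto.const_mul _ hh)
  refine tendsto_nhds_unique h2 (h3.congr fun Λ => ?_)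
  simp only [Function.comp, hE, law_forall_particles_finset lam Λ hS]
  rw [ENNReal.toReal_ofReal (Real.exp_pos _).le]

/-- The occupied times in `T`. -/
noncomputable def occupied (γ : ℤ → Lattice d) (T : Finset ℤ) (w : Sample d) : Finset ℤ :=
  T.filter fun t => environment w t (γ t) = 1

lemma mem_occupied {γ : ℤ → Lattice d} {T : Finset ℤ} {w : Sample d} {t : ℤ} :
    t ∈ occupied γ T w ↔ ∃ z i, i < w.1 z ∧ t ∈ visits γ T 0 z (particleJumps w z i) := by
  rw [occupied, mem_filter, environment_eq_one_iff]
  simp only [mem_visits]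
  have : ∀ z i, position w z i t = z + disp (particleJumps w z i) 0 t := fun z i => by
    rw [position, disp, ← add_sub_assoc]; rfl
  simp only [this]
  constructor
  · rintro ⟨ht, z, i, hi, h⟩; exact ⟨z, i, hi, ht, h⟩
  · rintro ⟨z, i, hi, ht, h⟩; exact ⟨ht, z, i, hi, h⟩

lemma measurableSet_occupied (γ : ℤ → Lattice d) (T : Finset ℤ) (Q : Finset ℤ → Prop) :
    MeasurableSet {w : Sample d | Q (occupied γ T w)} :=
  measurableSet_filter T (fun w t => environment w t (γ t) = 1)
    (fun t _ => measurable_environment t (γ t) (measurableSet_singleton 1)) Q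

/-- The void probabilities of the field along a path. -/
theorem law_occupied_subset (lam : ℝ≥0) (γ : ℤ → Lattice d) (T C : Finset ℤ) :
    (law lam p).real {w | occupied γ T w ⊆ C}
      = Real.exp (-∑ H ∈ visitSets T with ¬ H ⊆ C, intensity lam p γ T H) := by
  set S : Lattice d → Set (ℤ → Lattice d) := fun z => {ξ | visits γ T 0 z ξ ⊆ C} with hS
  have hSm : ∀ z, MeasurableSet (S z) := fun z => measurableSet_visits γ T 0 z (· ⊆ C)
  have hset : {w : Sample d | occupied γ T w ⊆ C}
      = {w | ∀ z, ∀ i < w.1 z, particleJumps w z i ∈ S z} := by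
    ext w
    simp only [Set.mem_ofPred_eq, hS]
    constructor
    · exact fun h z i hi t ht => h (mem_occupied.2 ⟨z, i, hi, ht⟩)
    · intro h t ht
      obtain ⟨z, i, hi, ht⟩ := mem_occupied.1 ht
      exact h z i hi ht
  -- A walk violates the constraint exactly when its set of visits is one of the finitely many `H`
  -- not contained in `C`. Such an `H` is nonempty, so re-rooting at one of its times shows that the
  -- sum over `z` is finite.
  have hsum : HasSum (fun z => (jumpLaw p).real (S z)ᶜ)
      (∑ H ∈ visitSets T with ¬ H ⊆ C, (∑' z, jumpLaw p {ξ | visits γ T 0 z ξ = H}).toReal) := by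
    have h1 : ∀ H ∈ (visitSets T).filter (fun H => ¬ H ⊆ C),
        HasSum (fun z => (jumpLaw p).real {ξ | visits γ T 0 z ξ = H})
          (∑' z, jumpLaw p {ξ | visits γ T 0 z ξ = H}).toReal := by
      intro H hH
      obtain ⟨r, hr⟩ := (mem_visitSets.1 (mem_filter.1 hH).1).1
      rw [ENNReal.tsum_toReal_eq fun z => measure_ne_top _ _]
      refine (ENNReal.summable_toReal ?_).hasSum
      rw [tsum_visits_eq hr]
      exact measure_ne_top _ _
    have h2 : (fun z => (jumpLaw p).real (S z)ᶜ) = fun z =>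
        ∑ H ∈ visitSets T with ¬ H ⊆ C, (jumpLaw p).real {ξ | visits γ T 0 z ξ = H} := by
      funext z
      rw [← measureReal_biUnion_finset]
      · congr 1
        ext ξ
        simp only [hS, Set.mem_compl_iff, Set.mem_ofPred_eq, Set.mem_iUnion, mem_filter,
          mem_visitSets, exists_prop]
        constructor
        · intro h
          refine ⟨_, ⟨⟨?_, visits_subset γ T 0 z ξ⟩, h⟩, rfl⟩
          rw [nonempty_iff_ne_empty]
          intro h0
          rw [h0] at h
          exact h (empty_subset C)
        · rintro ⟨H, ⟨_, hH⟩, rfl⟩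
          exact hH
      · intro H _ H' _ hne
        refine Set.disjoint_left.2 fun ξ h h' => hne ?_
        exact Eq.trans (Eq.symm h) h'
      · exact fun H _ => measurableSet_visits γ T 0 z (· = H)
    rw [h2]
    exact hasSum_sum h1
  rw [hset, law_forall_particles lam hSm hsum]
  congr 1
  rw [neg_mul, mul_sum]
  rfl

end VoidProbabilities

/-! ### Identification of the field with the finite model. -/

section FiniteLaw

open Finset

variable {d : ℕ} {p : PMF (Lattice d)}

/-- Two functions on the subsets of `T` agree if their sums over the subsets of each `C ⊆ T` do. -/
lemma eq_of_sum_powerset_eq {ι : Type*} [DecidableEq ι] {T : Finset ι} {f g : Finset ι → ℝ}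
    (h : ∀ C ⊆ T, ∑ D ∈ C.powerset, f D = ∑ D ∈ C.powerset, g D) : ∀ C ⊆ T, f C = g C := by
  intro C
  induction C using Finset.strongInduction with
  | H C ih =>
    intro hC
    have h1 := h C hC
    have hself : C ∈ C.powerset := mem_powerset_self C
    rw [← add_sum_erase _ f hself, ← add_sum_erase _ g hself] at h1
    have h2 : ∑ D ∈ C.powerset.erase C, f D = ∑ D ∈ C.powerset.erase C, g D := by
      refine Finset.sum_congr rfl fun D hD => ?_
      rw [mem_erase, mem_powerset] at hD
      exact ih D (hD.2.ssubset_of_ne hD.1) (hD.2.trans hC)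
    linarith

/-- The odds of the sets of visits in the finite model. -/
noncomputable def odds (lam : ℝ≥0) (p : PMF (Lattice d)) (γ : ℤ → Lattice d) (T H : Finset ℤ) : ℝ :=
  Real.exp (intensity lam p γ T H) - 1

lemma one_add_odds (lam : ℝ≥0) (γ : ℤ → Lattice d) (T H : Finset ℤ) :
    1 + odds lam p γ T H = Real.exp (intensity lam p γ T H) := by
  rw [odds]; ring

/-- The law of the set of occupied times is the law of the union of the sets of the finite
model. -/
theorem law_occupied_mul (lam : ℝ≥0) (γ : ℤ → Lattice d) (T : Finset ℤ) (Q : Finset ℤ → Prop) :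
    (law lam p).real {w | Q (occupied γ T w)}
        * subsetSum (odds lam p γ T) (visitSets T) (fun _ => 1)
      = subsetSum (odds lam p γ T) (visitSets T) (fun c => ind (Q (cover c))) := by
  classical
  set a := odds lam p γ T with ha
  set U := visitSets T with hU
  set Z := subsetSum a U (fun _ => 1) with hZ
  have hcover : ∀ c ⊆ U, cover c ⊆ T := by
    intro c hc t ht
    obtain ⟨H, hH, htH⟩ := mem_cover.1 ht
    exact (mem_visitSets.1 (hc hH)).2 htH
  have hprob : ∀ R : Finset ℤ → Prop, (law lam p).real {w | R (occupied γ T w)}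
      = ∑ C ∈ T.powerset with R C, (law lam p).real {w | occupied γ T w = C} := by
    intro R
    rw [← measureReal_biUnion_finset]
    · congr 1
      ext w
      simp only [Set.mem_ofPred_eq, Set.mem_iUnion, mem_filter, mem_powerset, exists_prop]
      constructor
      · exact fun h => ⟨_, ⟨filter_subset _ _, h⟩, rfl⟩
      · rintro ⟨C, ⟨_, hC⟩, rfl⟩
        exact hC
    · intro C _ C' _ hne
      refine Set.disjoint_left.2 fun w h h' => hne ?_
      exact Eq.trans (Eq.symm h) h'
    · exact fun C _ => measurableSet_occupied γ T (· = C)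
  have hmodel : ∀ R : Finset ℤ → Prop, subsetSum a U (fun c => ind (R (cover c)))
      = ∑ C ∈ T.powerset with R C, subsetSum a U (fun c => ind (cover c = C)) := by
    intro R
    rw [← subsetSum_sum]
    refine subsetSum_congr fun c hc => ?_
    by_cases h : R (cover c)
    · rw [ind_pos h, Finset.sum_eq_single (cover c)]
      · rw [ind_pos rfl]
      · exact fun C _ hne => ind_neg hne.symm
      · exact fun hn => absurd (mem_filter.2 ⟨mem_powerset.2 (hcover c hc), h⟩) hn
    · rw [ind_neg h]
      refine (Finset.sum_eq_zero fun C hC => ind_neg ?_).symm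
      rintro rfl
      exact h (mem_filter.1 hC).2
  -- In the model the union lies in `C` iff every chosen set does, which has weight `∏ (1 + a H)`
  -- over `H ⊆ C`. As `1 + a H` is the exponential of the intensity, dividing by `Z` leaves the void
  -- probability of the field.
  have hvoid : ∀ C ⊆ T, (law lam p).real {w | occupied γ T w ⊆ C} * Z
      = subsetSum a U (fun c => ind (cover c ⊆ C)) := by
    intro C _
    have h1 : subsetSum a U (fun c => ind (cover c ⊆ C)) = ∏ H ∈ U with H ⊆ C, (1 + a H) := by
      rw [subsetSum_ind, Finset.prod_one_add]
      refine Finset.sum_congr ?_ fun _ _ => rfl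
      ext c
      simp only [mem_filter, mem_powerset]
      constructor
      · rintro ⟨h1, h2⟩ H hH
        exact mem_filter.2 ⟨h1 hH, fun t ht => h2 (mem_cover.2 ⟨H, hH, ht⟩)⟩
      · intro h
        refine ⟨fun H hH => (mem_filter.1 (h hH)).1, fun t ht => ?_⟩
        obtain ⟨H, hH, ht⟩ := mem_cover.1 ht
        exact (mem_filter.1 (h hH)).2 ht
    rw [h1, law_occupied_subset, hZ, subsetSum_one]
    simp only [ha, one_add_odds]
    rw [← Real.exp_sum, ← Real.exp_sum, ← Real.exp_add,
      ← Finset.sum_filter_add_sum_filter_not U (· ⊆ C)]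
    congr 1
    ring
  have hpow : ∀ C ⊆ T, ∀ _ : DecidablePred fun D : Finset ℤ => D ⊆ C,
      T.powerset.filter (fun D => D ⊆ C) = C.powerset := by
    intro C hC _
    ext D
    simp only [mem_filter, mem_powerset]
    exact ⟨fun h => h.2, fun h => ⟨h.trans hC, h⟩⟩
  -- Inclusion–exclusion: void probabilities determine point probabilities.
  have hpt := eq_of_sum_powerset_eq (T := T)
    (f := fun C => (law lam p).real {w | occupied γ T w = C} * Z)
    (g := fun C => subsetSum a U (fun c => ind (cover c = C))) (by
      intro C hC
      have h1 := hvoid C hC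
      rw [hprob (· ⊆ C), hmodel (· ⊆ C), hpow C hC, sum_mul] at h1
      exact h1)
  rw [hprob Q, hmodel Q, sum_mul]
  exact Finset.sum_congr rfl fun C hC => hpt C (mem_powerset.1 (mem_filter.1 hC).1)

/-- Decoupling of the past and the future of the occupied times of a finite set of times. -/
theorem abs_law_occupied_sub_le {lam : ℝ≥0} {γ : ℤ → Lattice d} {Tp Tf : Finset ℤ} {δ : ℝ}
    {q : ℤ → ℝ} {β : ℤ → Finset ℤ → ℝ}
    (hB : IntensityBounds (visitSets (Tp ∪ Tf)) Tp Tf (intensity lam p γ (Tp ∪ Tf)) lam δ q β)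
    (S : Finset ℤ) (B : Finset ℤ → Prop) :
    |(law lam p).real {w | occupied γ Tp w = S ∧ B (occupied γ Tf w)}
        - (law lam p).real {w | occupied γ Tp w = S} * (law lam p).real {w | B (occupied γ Tf w)}|
      ≤ (2 * ∑ H ∈ crossing (visitSets (Tp ∪ Tf)) Tp Tf, intensity lam p γ (Tp ∪ Tf) H
          + Real.exp lam / δ * ∑ r ∈ Tp, q r) * (law lam p).real {w | occupied γ Tp w = S} := by
  have hTp : ∀ w : Sample d, occupied γ (Tp ∪ Tf) w ∩ Tp = occupied γ Tp w := by
    intro w; ext t; simp only [occupied, mem_inter, mem_filter, mem_union]; tauto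
  have hTf : ∀ w : Sample d, occupied γ (Tp ∪ Tf) w ∩ Tf = occupied γ Tf w := by
    intro w; ext t; simp only [occupied, mem_inter, mem_filter, mem_union]; tauto
  have h := abs_subsetSum_sub_le (S := S) hB (fun H => rfl) B
  change |_ * subsetSum (odds lam p γ (Tp ∪ Tf)) _ _ - _| ≤ _ at h
  have h1 := law_occupied_mul (p := p) lam γ (Tp ∪ Tf) fun C => C ∩ Tp = S ∧ B (C ∩ Tf)
  have h2 := law_occupied_mul (p := p) lam γ (Tp ∪ Tf) fun C => C ∩ Tp = S
  have h3 := law_occupied_mul (p := p) lam γ (Tp ∪ Tf) fun C => B (C ∩ Tf)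
  simp only [hTp, hTf] at h1 h2 h3
  set Z := subsetSum (odds lam p γ (Tp ∪ Tf)) (visitSets (Tp ∪ Tf)) (fun _ => 1) with hZ
  have hZ0 : 0 < Z := by
    rw [hZ, subsetSum_one]
    exact Finset.prod_pos fun H _ => by rw [one_add_odds]; exact Real.exp_pos _
  -- Model weights are `Z` times probabilities, and the model inequality is homogeneous of degree
  -- two, so `Z * Z` cancels.
  have h' : ∀ P K A B' : ℝ, |P * Z * Z - A * Z * (B' * Z)| ≤ K * (A * Z * Z) →
      |P - A * B'| ≤ K * A := by
    intro P K A B' h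
    have e1 : P * Z * Z - A * Z * (B' * Z) = (P - A * B') * (Z * Z) := by ring
    have e2 : K * (A * Z * Z) = (K * A) * (Z * Z) := by ring
    rw [e1, e2, abs_mul, abs_of_pos (mul_pos hZ0 hZ0)] at h
    exact le_of_mul_le_mul_right h (mul_pos hZ0 hZ0)
  apply h'
  rw [h1, h2, h3]
  exact h

end FiniteLaw

/-! ### From cylinder events to total variation. -/

section Mixing

open Finset

variable {d : ℕ} {p : PMF (Lattice d)}

/-- A bound for the difference of two finite measures extends from an algebra of sets to the
σ-algebra that it generates. -/
lemma abs_measureReal_sub_le_of_isSetAlgebra {α : Type*} [mα : MeasurableSpace α] {μ ν : Measure α}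
    [IsFiniteMeasure μ] [IsFiniteMeasure ν] {𝒜 : Set (Set α)} (h𝒜 : IsSetAlgebra 𝒜)
    (hgen : mα = MeasurableSpace.generateFrom 𝒜) {K : ℝ}
    (h : ∀ A ∈ 𝒜, |μ.real A - ν.real A| ≤ K) {B : Set α} (hB : MeasurableSet B) :
    |μ.real B - ν.real B| ≤ K := by
  refine le_of_forall_pos_le_add fun ε hε => ?_
  -- Approximating with respect to `μ + ν` yields a single set `A` close to `B` for both measures.
  have hdense := Measure.MeasureDense.of_generateFrom_isSetAlgebra_finite (μ + ν) h𝒜 hgen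
  obtain ⟨A, hA, hAB⟩ := hdense.approx B hB (measure_ne_top _ _) ε hε
  have hAm := hdense.measurable A hA
  have h1 : μ.real (symmDiff B A) + ν.real (symmDiff B A) ≤ ε := by
    rw [← measureReal_add_apply]
    exact (ENNReal.toReal_lt_of_lt_ofReal hAB).le
  have h2 := abs_measureReal_sub_le_measureReal_symmDiff (μ := μ) hB.nullMeasurableSet
    hAm.nullMeasurableSet
  have h3 := abs_measureReal_sub_le_measureReal_symmDiff (μ := ν) hB.nullMeasurableSet
    hAm.nullMeasurableSet
  have h4 := h A hA
  rw [abs_le] at *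
  constructor <;> linarith

lemma pastEvent_eq_occupied (γ : ℤ → Lattice d) (l : ℕ) (σ : ℤ → Fin 2) :
    pastEvent γ l σ = {w | occupied γ (Icc (-(l : ℤ)) 0) w
      = (Icc (-(l : ℤ)) 0).filter fun i => σ i = 1} := by
  ext w
  simp only [pastEvent, occupied, Set.mem_ofPred_eq, Finset.filter_inj', occupation, Set.mem_Icc,
    mem_Icc]
  refine forall_congr' fun i => forall_congr' fun _ => ?_
  omega

lemma exists_future_mem_cylinder_iff (γ : ℤ → Lattice d) (n : ℕ) (s : Finset ℕ)
    (A : Set (s → Fin 2)) : ∃ B : Finset ℤ → Prop, ∀ w : Sample d,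
      future γ n w ∈ cylinder s A ↔ B (occupied γ (s.image fun k : ℕ => (n : ℤ) + k) w) := by
  refine ⟨fun C => (fun k : s => if (n : ℤ) + (k : ℕ) ∈ C then (1 : Fin 2) else 0) ∈ A, fun w => ?_⟩
  rw [mem_cylinder]
  have : s.restrict (future γ n w) = fun k : s =>
      if (n : ℤ) + (k : ℕ) ∈ occupied γ (s.image fun k : ℕ => (n : ℤ) + k) w
        then (1 : Fin 2) else 0 := by
    funext k
    have hk : (n : ℤ) + (k : ℕ) ∈ s.image fun k : ℕ => (n : ℤ) + k :=
      mem_image_of_mem _ k.2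
    simp only [Finset.restrict, future, occupation, occupied, mem_filter, hk, true_and]
    split_ifs with h
    · exact h
    · omega
  rw [this]

/-- Uniform mixing of the occupation process along a deterministic path. -/
theorem exists_tvDist_future_le (hd : 5 ≤ d) (lam : ℝ≥0) (hfin : p.support.Finite)
    (hdim : TrulyDimensional p) :
    ∃ C : ℝ, ∀ (γ : ℤ → Lattice d) (n : ℕ), 1 ≤ n → ∀ (σ : ℤ → Fin 2) (l : ℕ),
      law lam p (pastEvent γ l σ) ≠ 0 →
      tvDist ((cond (law lam p) (pastEvent γ l σ)).map (future γ n)) ((law lam p).map (future γ n))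
        ≤ C * (n : ℝ) ^ (-(d : ℝ) / 2 + 2) := by
  obtain ⟨C, hC0, hC⟩ := exists_heatKernel_bound hfin hdim
  obtain ⟨δ, hδ, hesc⟩ := exists_escape_bound (by omega) hfin hdim
  obtain ⟨C', hC'0, hC'⟩ := exists_sum_hitBound_le hd hC0
  -- Each of the two crossing sums is at most `lam` times the sum of the hitting bounds, and the
  -- essential sets contribute `exp lam / δ` times that sum.
  refine ⟨(2 * lam + Real.exp lam / δ) * C', fun γ n hn σ l hpos => ?_⟩
  have hpast : MeasurableSet (pastEvent γ l σ) := measurableSet_pastEvent γ l σ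
  have hfut : Measurable (future γ n) := measurable_future γ n
  have := cond_isProbabilityMeasure hpos
  have := Measure.isProbabilityMeasure_map (μ := cond (law lam p) (pastEvent γ l σ)) hfut.aemeasurable
  have := Measure.isProbabilityMeasure_map (μ := law lam p) hfut.aemeasurable
  have hcyl : ∀ A ∈ measurableCylinders fun _ : ℕ => Fin 2,
      |((cond (law lam p) (pastEvent γ l σ)).map (future γ n)).real A
        - ((law lam p).map (future γ n)).real A|
        ≤ (2 * lam + Real.exp lam / δ) * C' * (n : ℝ) ^ (-(d : ℝ) / 2 + 2) := by
    intro A hA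
    have hAm : MeasurableSet A := MeasurableSet.of_mem_measurableCylinders hA
    obtain ⟨s, A', hA', rfl⟩ := (mem_measurableCylinders A).1 hA
    obtain ⟨B, hB⟩ := exists_future_mem_cylinder_iff γ n s A'
    set Tp := Icc (-(l : ℤ)) 0 with hTp
    set Tf := s.image fun k : ℕ => (n : ℤ) + k with hTf
    set S := Tp.filter fun i => σ i = 1 with hS
    have hTp0 : ∀ r ∈ Tp, r ≤ 0 := fun r hr => (mem_Icc.1 hr).2
    have hTfn : ∀ t ∈ Tf, (n : ℤ) ≤ t := by
      intro t ht
      obtain ⟨k, _, rfl⟩ := mem_image.1 ht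
      omega
    have hpf : ∀ r ∈ Tp, ∀ t ∈ Tf, r < t := fun r hr t ht => by
      have h1 := hTp0 r hr
      have h2 := hTfn t ht
      omega
    have hq := hC' n hn Tp Tf hTp0 hTfn
    have hcross := sum_crossing_le (lam := lam) hfin hC γ hpf
    have hmain := abs_law_occupied_sub_le
      (intensityBounds (lam := lam) hfin hC0 hC hδ hesc γ hpf) S B
    have hP : pastEvent γ l σ = {w | occupied γ Tp w = S} := pastEvent_eq_occupied γ l σ
    have hF : future γ n ⁻¹' cylinder s A' = {w | B (occupied γ Tf w)} := Set.ext hB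
    have hcond : ∀ E : Set (Sample d), (cond (law lam p) (pastEvent γ l σ)).real E
        = ((law lam p).real (pastEvent γ l σ))⁻¹ * (law lam p).real (pastEvent γ l σ ∩ E) := by
      intro E
      rw [Measure.real, cond_apply hpast, ENNReal.toReal_mul, ENNReal.toReal_inv]
      rfl
    rw [map_measureReal_apply hfut hAm, map_measureReal_apply hfut hAm, hF,
      hcond, hP]
    rw [hP] at hpos
    set P := (law lam p).real {w | occupied γ Tp w = S} with hPdef
    have hP0 : 0 < P := ENNReal.toReal_pos hpos (measure_ne_top _ _)
    have hinter : {w : Sample d | occupied γ Tp w = S} ∩ {w | B (occupied γ Tf w)}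
        = {w | occupied γ Tp w = S ∧ B (occupied γ Tf w)} := rfl
    rw [hinter]
    set PF := (law lam p).real {w | occupied γ Tp w = S ∧ B (occupied γ Tf w)}
    set F := (law lam p).real {w | B (occupied γ Tf w)}
    have heq : P⁻¹ * PF - F = P⁻¹ * (PF - P * F) := by field_simp
    rw [heq, abs_mul, abs_of_pos (inv_pos.2 hP0), inv_mul_le_iff₀ hP0,
      mul_comm P (_ * _ * _)]
    refine hmain.trans (mul_le_mul_of_nonneg_right ?_ hP0.le)
    have hexp : 0 ≤ Real.exp lam / δ := by positivity
    set X := ∑ r ∈ Tp, hitBound d C Tf r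
    calc 2 * ∑ H ∈ crossing (visitSets (Tp ∪ Tf)) Tp Tf, intensity lam p γ (Tp ∪ Tf) H
          + Real.exp lam / δ * X
        ≤ 2 * (lam * X) + Real.exp lam / δ * X := by linarith
      _ = (2 * lam + Real.exp lam / δ) * X := by ring
      _ ≤ (2 * lam + Real.exp lam / δ) * (C' * (n : ℝ) ^ (-(d : ℝ) / 2 + 2)) :=
          mul_le_mul_of_nonneg_left hq (by positivity)
      _ = _ := by ring
  have : Nonempty {B : Set (ℕ → Fin 2) // MeasurableSet B} := ⟨⟨∅, MeasurableSet.empty⟩⟩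
  exact ciSup_le fun B => abs_measureReal_sub_le_of_isSetAlgebra isSetAlgebra_measurableCylinders
    generateFrom_measurableCylinders.symm hcyl B.2

end Mixing

end PoissonWalks

theorem corollary5p3 (d : ℕ) (hd : 5 ≤ d) (lam : ℝ≥0) (hlam : 0 < lam)
    (p : PMF (PoissonWalks.Lattice d)) (hfin : p.support.Finite)
    (hdim : PoissonWalks.TrulyDimensional p) :
    ∃ C : ℝ, ∀ (γ : ℤ → PoissonWalks.Lattice d) (n : ℕ), 1 ≤ n →
      ∀ (σ : ℤ → Fin 2) (l : ℕ),
        PoissonWalks.law lam p (PoissonWalks.pastEvent γ l σ) ≠ 0 →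
        PoissonWalks.tvDist
          ((ProbabilityTheory.cond (PoissonWalks.law lam p)
            (PoissonWalks.pastEvent γ l σ)).map (PoissonWalks.future γ n))
          ((PoissonWalks.law lam p).map (PoissonWalks.future γ n))
          ≤ C * (n : ℝ) ^ (-(d : ℝ) / 2 + 2) :=
  PoissonWalks.exists_tvDist_future_le hd lam hfin hdim
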